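/- Let $A,B$ be quantum systems with Hilbert spaces $\mathbb{C}^{d_A},\mathbb{C}^{d_B}$, $d_A,d_B\ge 1$, and let $A',B'$ be copies of $A,B$. Write $I$ for the identity map, $\mathds{1}\mathrm{Tr}$ for the map $X\mapsto \mathrm{Tr}(X)\,\mathds{1}$, and $|\varepsilon\rangle=d^{-1/2}\sum_{i=1}^d|ii\rangle$ for the maximally entangled vector of $AA'$ ($d=d_A$), $BB'$ ($d=d_B$) or $AB\,|\,A'B'$ ($d=d_Ad_B$, where $i$ runs over the product basis). For real $\alpha,\beta,\gamma$ let $$\Phi[\alpha,\beta,\gamma]=\mathds{1}_{AB}\mathrm{Tr}+\alpha\,\mathds{1}_A\mathrm{Tr}\otimes I+\beta\, I\otimes\mathds{1}_B\mathrm{Tr}+\gamma\, I ,$$ and put $$R_{ABA'B'}=\mathds{1}-\mathds{1}_{AA'}\otimes|\varepsilon\rangle\langle\varepsilon|_{BB'}-|\varepsilon\rangle\langle\varepsilon|_{AA'}\otimes\mathds{1}_{BB'}+(d_Ad_B-d_B+d_A)\,|\varepsilon\rangle\langle\varepsilon|_{AA'}\otimes|\varepsilon\rangle\langle\varepsilon|_{BB'}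 .$$ A map is completely positive (resp. positive) if $\Lambda\otimes I_k$ for every $k\ge 0$ (resp. $\Lambda$) preserves positive semidefiniteness, completely copositive if its composition with the transposition is completely positive, and decomposable if it is the sum of a completely positive and a completely copositive map. A bipartite operator is separable if it is a finite sum of tensor products of positive semidefinite operators. A map $\Lambda$ is entanglement-breaking if $(\Lambda\otimes I_k)(\rho)$ is separable for every $k$ and every $\rho\ge 0$. 1. If $2\le d_A<d_B$, then $R$ equals $d_Ad_B$ times the Choi operator $(\Phi\otimes I)(|\varepsilon\rangle\langle\varepsilon|_{AB|A'B'})$ of $\Phi=\Phi\big[-\tfrac1{d_B},-\tfrac1{d_A},1-\tfrac{d_B-d_A}{d_Ad_B}\big]$, and, normalised to unit trace, it is a PPT entangled state across $AB|A'B'$: it is positive semidefinite with trace one, its partial transpose is positive semidefinite, and it is not separable. 2. If $d_A<d_B$, then the map $\Psi=I_A\otimes\big(\mathds{1}\mathrm{Tr}-I/d_A\big)_B$ on $AB$ is positive. If moreover $d_A\ge2$, it is not decomposable, and it detects $R$, i.e. $(\Psi_{AB}\otimes I_{A'B'})(R)$ is not positive semidefinite. 3. If $d_A\le d_B$, then $\Phi\big[-\tfrac1{d_B},-\tfrac1{d_B},1\big]$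 is entanglement-breaking. -/

import Mathlib

open Matrix
open scoped Kronecker ComplexOrder

namespace QMaps

/-- Linear maps (superoperators) on the complex matrices indexed by `n`. -/
abbrev SuperOp (n : Type*) := Matrix n n ℂ →ₗ[ℂ] Matrix n n ℂ

/-- `Λ ⊗ id` on a bipartite system `n × m`, the map `Λ` acting on the first factor. -/
def leftAmp {n : Type*} (m : Type*) (Λ : SuperOp n) : SuperOp (n × m) where
  toFun ρ := Matrix.of fun p q => Λ (Matrix.of fun i j => ρ (i, p.2) (j, q.2)) p.1 q.1
  map_add' ρ σ := by
    ext p q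
    have h : (Matrix.of fun i j => (ρ + σ) (i, p.2) (j, q.2) : Matrix n n ℂ) =
        (Matrix.of fun i j => ρ (i, p.2) (j, q.2)) + Matrix.of fun i j => σ (i, p.2) (j, q.2) := by
      ext i j; simp
    have h' := congrArg Λ h
    rw [map_add] at h'
    exact congrFun (congrFun h' p.1) q.1
  map_smul' c ρ := by
    ext p q
    have h : (Matrix.of fun i j => (c • ρ) (i, p.2) (j, q.2) : Matrix n n ℂ) =
        c • (Matrix.of fun i j => ρ (i, p.2) (j, q.2)) := by
      ext i j; simp
    have h' := congrArg Λ h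
    rw [map_smul] at h'
    exact congrFun (congrFun h' p.1) q.1

/-- `id ⊗ Γ` on a bipartite system `n × m`, the map `Γ` acting on the second factor. -/
def rightAmp (n : Type*) {m : Type*} (Γ : SuperOp m) : SuperOp (n × m) where
  toFun ρ := Matrix.of fun p q => Γ (Matrix.of fun i j => ρ (p.1, i) (q.1, j)) p.2 q.2
  map_add' ρ σ := by
    ext p q
    have h : (Matrix.of fun i j => (ρ + σ) (p.1, i) (q.1, j) : Matrix m m ℂ) =
        (Matrix.of fun i j => ρ (p.1, i) (q.1, j)) + Matrix.of fun i j => σ (p.1, i) (q.1, j) := by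
      ext i j; simp
    have h' := congrArg Γ h
    rw [map_add] at h'
    exact congrFun (congrFun h' p.2) q.2
  map_smul' c ρ := by
    ext p q
    have h : (Matrix.of fun i j => (c • ρ) (p.1, i) (q.1, j) : Matrix m m ℂ) =
        c • (Matrix.of fun i j => ρ (p.1, i) (q.1, j)) := by
      ext i j; simp
    have h' := congrArg Γ h
    rw [map_smul] at h'
    exact congrFun (congrFun h' p.2) q.2

/-- The tensor product `Λ ⊗ Γ` of two maps. -/
def tensorMap {n m : Type*} (Λ : SuperOp n) (Γ : SuperOp m) : SuperOp (n × m) :=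
  leftAmp m Λ ∘ₗ rightAmp n Γ

/-- The defining property of the tensor product of maps. -/
theorem tensorMap_kronecker {n m : Type*} (Λ : SuperOp n) (Γ : SuperOp m)
    (X : Matrix n n ℂ) (Y : Matrix m m ℂ) :
    tensorMap Λ Γ (X ⊗ₖ Y) = Λ X ⊗ₖ Γ Y := by
  have h1 : rightAmp n Γ (X ⊗ₖ Y) = X ⊗ₖ Γ Y := by
    ext p q
    have h : (Matrix.of fun i j => (X ⊗ₖ Y) (p.1, i) (q.1, j) : Matrix m m ℂ) =
        X p.1 q.1 • Y := by ext i j; simp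
    change Γ (Matrix.of fun i j => (X ⊗ₖ Y) (p.1, i) (q.1, j)) p.2 q.2 = _
    rw [h, map_smul]; simp [Matrix.kroneckerMap_apply]
  have h2 : leftAmp m Λ (X ⊗ₖ Γ Y) = Λ X ⊗ₖ Γ Y := by
    ext p q
    have h : (Matrix.of fun i j => (X ⊗ₖ Γ Y) (i, p.2) (j, q.2) : Matrix n n ℂ) =
        Γ Y p.2 q.2 • X := by ext i j; simp [mul_comm]
    change Λ (Matrix.of fun i j => (X ⊗ₖ Γ Y) (i, p.2) (j, q.2)) p.1 q.1 = _
    rw [h, map_smul]; simp [Matrix.kroneckerMap_apply, mul_comm]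
  rw [tensorMap, LinearMap.comp_apply, h1, h2]

/-- The map `𝟙 Tr : X ↦ Tr(X) 𝟙`. -/
def oneTr (n : Type*) [Fintype n] [DecidableEq n] : SuperOp n :=
  (Matrix.traceLinearMap n ℂ ℂ).smulRight (1 : Matrix n n ℂ)

/-- The transposition map. -/
def transposeMap (n : Type*) : SuperOp n :=
  (Matrix.transposeLinearEquiv n n ℂ ℂ).toLinearMap

/-- Positive maps. -/
def IsPositiveMap {n : Type*} (Λ : SuperOp n) : Prop :=
  ∀ X : Matrix n n ℂ, X.PosSemidef → (Λ X).PosSemidef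

/-- Completely positive maps: `Λ ⊗ id` is positive for every finite-dimensional ancilla. -/
def IsCompletelyPositive {n : Type*} (Λ : SuperOp n) : Prop :=
  ∀ k : ℕ, IsPositiveMap (leftAmp (Fin k) Λ)

/-- Completely copositive maps. -/
def IsCompletelyCopositive {n : Type*} (Λ : SuperOp n) : Prop :=
  IsCompletelyPositive (transposeMap n ∘ₗ Λ)

/-- Decomposable maps: sums of a completely positive and a completely copositive map. -/
def IsDecomposable {n : Type*} (Λ : SuperOp n) : Prop :=
  ∃ Λ₁ Λ₂ : SuperOp n,
    IsCompletelyPositive Λ₁ ∧ IsCompletelyCopositive Λ₂ ∧ Λ = Λ₁ + Λ₂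

/-- Separability of a (not necessarily normalised) operator on a bipartite system `n × m`,
across the cut `n | m`: it is a finite sum of products of positive semidefinite operators. -/
def IsSeparable {n m : Type*} (ρ : Matrix (n × m) (n × m) ℂ) : Prop :=
  ∃ (r : ℕ) (X : Fin r → Matrix n n ℂ) (Y : Fin r → Matrix m m ℂ),
    (∀ s, (X s).PosSemidef) ∧ (∀ s, (Y s).PosSemidef) ∧ ρ = ∑ s, X s ⊗ₖ Y s

/-- Entanglement-breaking maps: `Λ ⊗ id` has separable outputs for every ancilla. -/
def IsEntanglementBreaking {n : Type*} (Λ : SuperOp n) : Prop :=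
  ∀ (k : ℕ) (ρ : Matrix (n × Fin k) (n × Fin k) ℂ),
    ρ.PosSemidef → IsSeparable (leftAmp (Fin k) Λ ρ)

/-- A PPT entangled state across the cut `n | m`: a density matrix whose partial transpose is
positive semidefinite and that is not separable. -/
structure IsPPTEntangledState {n m : Type*} [Fintype n] [Fintype m]
    (ρ : Matrix (n × m) (n × m) ℂ) : Prop where
  posSemidef : ρ.PosSemidef
  trace_eq_one : ρ.trace = 1
  ppt : (rightAmp n (transposeMap m) ρ).PosSemidef
  entangled : ¬ IsSeparable ρ

/-- A map acting on the first factor of `n × m` detects `ρ` if `(Λ ⊗ id)(ρ)` fails to be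
positive semidefinite. -/
def Detects {n m : Type*} (Λ : SuperOp n) (ρ : Matrix (n × m) (n × m) ℂ) : Prop :=
  ¬ (leftAmp m Λ ρ).PosSemidef

/-- The maximally entangled vector `|ε⟩ = d^{-1/2} ∑ᵢ |ii⟩`, with `d` the cardinality of `n`. -/
noncomputable def maxEntVec (n : Type*) [Fintype n] [DecidableEq n] : n × n → ℂ :=
  fun p => if p.1 = p.2 then ((1 / Real.sqrt (Fintype.card n) : ℝ) : ℂ) else 0

/-- The projector `|ε⟩⟨ε|`. -/
noncomputable def maxEnt (n : Type*) [Fintype n] [DecidableEq n] :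
    Matrix (n × n) (n × n) ℂ :=
  Matrix.vecMulVec (maxEntVec n) (star (maxEntVec n))

/-- The Choi operator `(Λ ⊗ id)(|ε⟩⟨ε|)`. -/
noncomputable def choi {n : Type*} [Fintype n] [DecidableEq n] (Λ : SuperOp n) :
    Matrix (n × n) (n × n) ℂ :=
  leftAmp n Λ (maxEnt n)

/-- The operator `X_{AA'} ⊗ Y_{BB'}`, seen as an operator on the system ordered as `AB|A'B'`. -/
def pairTensor {a b : Type*} (X : Matrix (a × a) (a × a) ℂ) (Y : Matrix (b × b) (b × b) ℂ) :
    Matrix ((a × b) × (a × b)) ((a × b) × (a × b)) ℂ :=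
  Matrix.reindex (Equiv.prodProdProdComm a a b b) (Equiv.prodProdProdComm a a b b) (X ⊗ₖ Y)

/-- `Φ[α,β,γ] = 𝟙_{AB} Tr + α 𝟙_A Tr ⊗ I + β I ⊗ 𝟙_B Tr + γ I`, with `A = ℂ^{dA}`, `B = ℂ^{dB}`. -/
noncomputable def Phi (dA dB : ℕ) (α β γ : ℝ) : SuperOp (Fin dA × Fin dB) :=
  oneTr (Fin dA × Fin dB)
    + (α : ℂ) • tensorMap (oneTr (Fin dA)) LinearMap.id
    + (β : ℂ) • tensorMap LinearMap.id (oneTr (Fin dB))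
    + (γ : ℂ) • LinearMap.id

/-- The map `I_A ⊗ (𝟙 Tr - I / dA)_B`. -/
noncomputable def redMap (dA dB : ℕ) : SuperOp (Fin dA × Fin dB) :=
  tensorMap LinearMap.id (oneTr (Fin dB) - (1 / (dA : ℂ)) • LinearMap.id)

/-- The (unnormalised) operator
`R = 𝟙 - 𝟙_{AA'} ⊗ |ε⟩⟨ε|_{BB'} - |ε⟩⟨ε|_{AA'} ⊗ 𝟙_{BB'}
+ (dA dB - dB + dA) |ε⟩⟨ε|_{AA'} ⊗ |ε⟩⟨ε|_{BB'}`. -/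
noncomputable def opR (dA dB : ℕ) :
    Matrix ((Fin dA × Fin dB) × (Fin dA × Fin dB)) ((Fin dA × Fin dB) × (Fin dA × Fin dB)) ℂ :=
  1 - pairTensor 1 (maxEnt (Fin dB)) - pairTensor (maxEnt (Fin dA)) 1
    + ((dA : ℂ) * dB - dB + dA) • pairTensor (maxEnt (Fin dA)) (maxEnt (Fin dB))

end QMaps

open QMaps

/-! Write P for a maximally entangled projector and F for a flip. Parts 1 and 2 rest on two
diagonalisations of R. In terms of the commuting projectors P_A and P_B, `opR_eq_add` gives R =
(1-P_A)⊗(1-P_B) + (dA-1)(dB+1) P_A⊗P_B, which is visibly positive. Partial transposition turns P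
into F/d, and `rightAmp_transpose_opR` writes the result as a nonnegative combination of products of
(1±F_A) and (1±F_B). The map `redMap` is positive because |Tr X|² ≤ dA Tr(XᴴX) for X = MᴴN of rank
at most dA (`normSq_trace_conjTranspose_mul_le`), but its output on R has negative expectation in
P_A⊗P_B when 2 ≤ dA < dB. Positive maps preserve positivity on separable operators, and decomposable
maps preserve it on PPT operators, so R is entangled and `redMap` is not decomposable.

For part 3, let `φ` be the vector of a coisometry M, i.e. MMᴴ = 1; such M exist because dA ≤ dB. The
rescaled Choi operator is shown to be (dB²-1) times a finite convex combination of the product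
projectors onto φ⊗conj φ, which makes the map measure-and-prepare. Nearest-point projection replaces
Haar averaging: the convex hull of these projectors is compact and invariant under local unitaries,
so the difference D between its closest rescaled point and the target is invariant. Invariance
places D in the span of four operators (`exists_eq_smul_pairTensor_of_invariant`), while trace
identities make D orthogonal to all four. Hence D = 0. -/

namespace QMaps

/-! ### Tensor calculus across the cut AB|A'B'. -/

section PairTensor

variable {a b : Type*}

theorem pairTensor_apply (X : Matrix (a × a) (a × a) ℂ) (Y : Matrix (b × b) (b × b) ℂ)
    (p q : (a × b) × (a × b)) :
    pairTensor X Y p q =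
      X (p.1.1, p.2.1) (q.1.1, q.2.1) * Y (p.1.2, p.2.2) (q.1.2, q.2.2) := rfl

theorem pairTensor_add_left (X X' : Matrix (a × a) (a × a) ℂ) (Y : Matrix (b × b) (b × b) ℂ) :
    pairTensor (X + X') Y = pairTensor X Y + pairTensor X' Y := by
  ext p q; simp [pairTensor_apply, add_mul]

theorem pairTensor_add_right (X : Matrix (a × a) (a × a) ℂ) (Y Y' : Matrix (b × b) (b × b) ℂ) :
    pairTensor X (Y + Y') = pairTensor X Y + pairTensor X Y' := by
  ext p q; simp [pairTensor_apply, mul_add]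

theorem pairTensor_sub_left (X X' : Matrix (a × a) (a × a) ℂ) (Y : Matrix (b × b) (b × b) ℂ) :
    pairTensor (X - X') Y = pairTensor X Y - pairTensor X' Y := by
  ext p q; simp [pairTensor_apply, sub_mul]

theorem pairTensor_sub_right (X : Matrix (a × a) (a × a) ℂ) (Y Y' : Matrix (b × b) (b × b) ℂ) :
    pairTensor X (Y - Y') = pairTensor X Y - pairTensor X Y' := by
  ext p q; simp [pairTensor_apply, mul_sub]

theorem pairTensor_smul_left (c : ℂ) (X : Matrix (a × a) (a × a) ℂ)
    (Y : Matrix (b × b) (b × b) ℂ) : pairTensor (c • X) Y = c • pairTensor X Y := by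
  ext p q; simp [pairTensor_apply, mul_assoc]

theorem pairTensor_smul_right (c : ℂ) (X : Matrix (a × a) (a × a) ℂ)
    (Y : Matrix (b × b) (b × b) ℂ) : pairTensor X (c • Y) = c • pairTensor X Y := by
  ext p q; simp [pairTensor_apply, mul_left_comm]

theorem pairTensor_one_one [DecidableEq a] [DecidableEq b] :
    pairTensor (1 : Matrix (a × a) (a × a) ℂ) (1 : Matrix (b × b) (b × b) ℂ) = 1 := by
  simp [pairTensor]

theorem rightAmp_transpose_pairTensor (X : Matrix (a × a) (a × a) ℂ)
    (Y : Matrix (b × b) (b × b) ℂ) :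
    rightAmp (a × b) (transposeMap (a × b)) (pairTensor X Y) =
      pairTensor (rightAmp a (transposeMap a) X) (rightAmp b (transposeMap b) Y) := rfl

theorem leftAmp_id {n m : Type*} : leftAmp m (LinearMap.id : SuperOp n) = LinearMap.id := rfl

theorem leftAmp_sub {n m : Type*} (Λ Γ : SuperOp n) :
    leftAmp m (Λ - Γ) = leftAmp m Λ - leftAmp m Γ := rfl

theorem leftAmp_add {n m : Type*} (Λ Γ : SuperOp n) :
    leftAmp m (Λ + Γ) = leftAmp m Λ + leftAmp m Γ := rfl

theorem leftAmp_smul {n m : Type*} (c : ℂ) (Λ : SuperOp n) :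
    leftAmp m (c • Λ) = c • leftAmp m Λ := rfl

theorem leftAmp_tensorMap_id_pairTensor (Γ : SuperOp b) (X : Matrix (a × a) (a × a) ℂ)
    (Y : Matrix (b × b) (b × b) ℂ) :
    leftAmp (a × b) (tensorMap LinearMap.id Γ) (pairTensor X Y) =
      pairTensor X (leftAmp b Γ Y) := by
  ext p q
  rw [pairTensor_apply]
  change Γ (Matrix.of fun i j => X (p.1.1, p.2.1) (q.1.1, q.2.1) *
    Y (i, p.2.2) (j, q.2.2)) p.1.2 q.1.2 = _
  have h : (Matrix.of fun i j => X (p.1.1, p.2.1) (q.1.1, q.2.1) * Y (i, p.2.2) (j, q.2.2)) =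
      X (p.1.1, p.2.1) (q.1.1, q.2.1) • (Matrix.of fun i j => Y (i, p.2.2) (j, q.2.2)) := by
    ext; simp
  rw [h, map_smul]
  rfl

theorem leftAmp_tensorMap_pairTensor_id (Λ : SuperOp a) (X : Matrix (a × a) (a × a) ℂ)
    (Y : Matrix (b × b) (b × b) ℂ) :
    leftAmp (a × b) (tensorMap Λ LinearMap.id) (pairTensor X Y) =
      pairTensor (leftAmp a Λ X) Y := by
  ext p q
  rw [pairTensor_apply]
  change Λ (Matrix.of fun i j => X (i, p.2.1) (j, q.2.1) *
    Y (p.1.2, p.2.2) (q.1.2, q.2.2)) p.1.1 q.1.1 = _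
  have h : (Matrix.of fun i j => X (i, p.2.1) (j, q.2.1) * Y (p.1.2, p.2.2) (q.1.2, q.2.2)) =
      Y (p.1.2, p.2.2) (q.1.2, q.2.2) • (Matrix.of fun i j => X (i, p.2.1) (j, q.2.1)) := by
    ext; simp [mul_comm]
  rw [h, map_smul, Matrix.smul_apply, smul_eq_mul, mul_comm]
  rfl

theorem leftAmp_kronecker {n m : Type*} (Λ : SuperOp n) (X : Matrix n n ℂ) (Y : Matrix m m ℂ) :
    leftAmp m Λ (X ⊗ₖ Y) = Λ X ⊗ₖ Y :=
  tensorMap_kronecker Λ LinearMap.id X Y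

variable [Fintype a] [Fintype b]

theorem pairTensor_mul (X X' : Matrix (a × a) (a × a) ℂ) (Y Y' : Matrix (b × b) (b × b) ℂ) :
    pairTensor X Y * pairTensor X' Y' = pairTensor (X * X') (Y * Y') := by
  simp only [pairTensor, reindex_apply, submatrix_mul_equiv, mul_kronecker_mul]

theorem trace_pairTensor (X : Matrix (a × a) (a × a) ℂ) (Y : Matrix (b × b) (b × b) ℂ) :
    (pairTensor X Y).trace = X.trace * Y.trace := by
  rw [← trace_kronecker, pairTensor, reindex_apply]
  exact Fintype.sum_equiv (Equiv.prodProdProdComm a a b b).symm _ _ fun _ => rfl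

theorem _root_.Matrix.PosSemidef.pairTensor {X : Matrix (a × a) (a × a) ℂ}
    {Y : Matrix (b × b) (b × b) ℂ}
    (hX : X.PosSemidef) (hY : Y.PosSemidef) : (QMaps.pairTensor X Y).PosSemidef :=
  (hX.kronecker hY).submatrix _

end PairTensor

/-! ### Maximally entangled projectors, flips and partial transposition. -/

section MaxEnt

variable (n : Type*) [Fintype n] [DecidableEq n]

/-- The flip operator `|i j⟩ ↦ |j i⟩`. -/
def flipOp : Matrix (n × n) (n × n) ℂ :=
  Matrix.of fun p q => if p.1 = q.2 ∧ p.2 = q.1 then 1 else 0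

theorem maxEnt_apply (p q : n × n) :
    maxEnt n p q = if p.1 = p.2 ∧ q.1 = q.2 then (1 / (Fintype.card n : ℂ)) else 0 := by
  have h : ((√(Fintype.card n : ℝ) : ℂ))⁻¹ * ((√(Fintype.card n : ℝ) : ℂ))⁻¹ =
      (Fintype.card n : ℂ)⁻¹ := by
    rw [← mul_inv, ← Complex.ofReal_mul, Real.mul_self_sqrt (Nat.cast_nonneg _)]; simp
  by_cases h1 : p.1 = p.2 <;> by_cases h2 : q.1 = q.2 <;>
    simp [maxEnt, maxEntVec, vecMulVec_apply, h1, h2, h]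

theorem maxEnt_posSemidef : (maxEnt n).PosSemidef := posSemidef_vecMulVec_self_star _

theorem trace_maxEnt [Nonempty n] : (maxEnt n).trace = 1 := by
  simp [Matrix.trace, maxEnt_apply, Fintype.sum_prod_type]

theorem maxEnt_mul_self [Nonempty n] : maxEnt n * maxEnt n = maxEnt n := by
  ext p q
  by_cases h1 : p.1 = p.2 <;> by_cases h2 : q.1 = q.2 <;>
    simp [Matrix.mul_apply, maxEnt_apply, Fintype.sum_prod_type, h1, h2]

theorem posSemidef_of_isHermitian_of_mul_self {m : Type*} [Fintype m] {X : Matrix m m ℂ}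
    (h : X.IsHermitian) (h2 : X * X = X) : X.PosSemidef := by
  have := posSemidef_conjTranspose_mul_self X
  rwa [h.eq, h2] at this

theorem one_sub_maxEnt_posSemidef [Nonempty n] : (1 - maxEnt n).PosSemidef := by
  refine posSemidef_of_isHermitian_of_mul_self
    (isHermitian_one.sub (maxEnt_posSemidef n).isHermitian) ?_
  rw [mul_sub, sub_mul, sub_mul, maxEnt_mul_self]
  simp

theorem flip_mul_self : flipOp n * flipOp n = 1 := by
  ext ⟨i, j⟩ ⟨k, l⟩
  simp [Matrix.mul_apply, flipOp, Fintype.sum_prod_type, one_apply, ite_and]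

omit [Fintype n] in
theorem flip_isHermitian : (flipOp n).IsHermitian := by
  ext ⟨i, j⟩ ⟨k, l⟩
  simp [flipOp, and_comm, eq_comm]

/-- The flip is a Hermitian involution, so half of this operator is the projector onto the symmetric
subspace. -/
theorem one_add_flip_posSemidef : (1 + flipOp n).PosSemidef := by
  have h : ((1 / 2 : ℂ) • (1 + flipOp n)).PosSemidef := by
    refine posSemidef_of_isHermitian_of_mul_self ?_ ?_
    · exact (isHermitian_one.add (flip_isHermitian n)).smul (by simp [IsSelfAdjoint])
    · rw [smul_mul_smul_comm, mul_add, add_mul, add_mul, flip_mul_self]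
      simp only [one_mul, mul_one]
      module
  convert h.smul (show (0 : ℂ) ≤ 2 by norm_num) using 1
  module

theorem one_sub_flip_posSemidef : (1 - flipOp n).PosSemidef := by
  have h : ((1 / 2 : ℂ) • (1 - flipOp n)).PosSemidef := by
    refine posSemidef_of_isHermitian_of_mul_self ?_ ?_
    · exact (isHermitian_one.sub (flip_isHermitian n)).smul (by simp [IsSelfAdjoint])
    · rw [smul_mul_smul_comm, mul_sub, sub_mul, sub_mul, flip_mul_self]
      simp only [one_mul, mul_one]
      module
  convert h.smul (show (0 : ℂ) ≤ 2 by norm_num) using 1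
  module

omit [Fintype n] in
theorem rightAmp_transpose_one :
    rightAmp n (transposeMap n) 1 = (1 : Matrix (n × n) (n × n) ℂ) := by
  ext ⟨i, j⟩ ⟨k, l⟩
  simp [rightAmp, transposeMap, one_apply, eq_comm]

theorem rightAmp_transpose_maxEnt :
    rightAmp n (transposeMap n) (maxEnt n) = (1 / (Fintype.card n : ℂ)) • flipOp n := by
  ext ⟨i, j⟩ ⟨k, l⟩
  simp [rightAmp, transposeMap, maxEnt_apply, flipOp, eq_comm]

theorem leftAmp_oneTr_maxEnt :
    leftAmp n (oneTr n) (maxEnt n) =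
      (1 / (Fintype.card n : ℂ)) • (1 : Matrix (n × n) (n × n) ℂ) := by
  ext ⟨i, j⟩ ⟨k, l⟩
  by_cases h : j = l <;> by_cases h' : i = k <;>
    simp [leftAmp, oneTr, Matrix.trace, maxEnt_apply, one_apply, ite_and, h, h']

theorem maxEnt_prod (a b : Type*) [Fintype a] [DecidableEq a] [Fintype b] [DecidableEq b] :
    maxEnt (a × b) = pairTensor (maxEnt a) (maxEnt b) := by
  ext ⟨⟨p₁, p₂⟩, ⟨r₁, r₂⟩⟩ ⟨⟨q₁, q₂⟩, ⟨s₁, s₂⟩⟩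
  simp only [pairTensor_apply, maxEnt_apply, Prod.mk.injEq, Fintype.card_prod, Nat.cast_mul]
  by_cases h1 : p₁ = r₁ <;> by_cases h2 : p₂ = r₂ <;> by_cases h3 : q₁ = s₁ <;>
    by_cases h4 : q₂ = s₂ <;> simp [h1, h2, h3, h4, mul_comm]

end MaxEnt

/-! ### Positivity tests: separable operators and PPT operators. -/

section General

variable {n m : Type*}

/-- Complete positivity is defined with ancillas `Fin k`; relabelling the basis reaches every finite
ancilla. -/
theorem IsCompletelyPositive.leftAmp_posSemidef [Fintype m] {Λ : SuperOp n}
    (h : IsCompletelyPositive Λ) {ρ : Matrix (n × m) (n × m) ℂ} (hρ : ρ.PosSemidef) :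
    (leftAmp m Λ ρ).PosSemidef := by
  let e := Fintype.equivFin m
  exact (h (Fintype.card m) _ (hρ.submatrix (Prod.map id e.symm))).submatrix
    (Prod.map id e) |> fun h' => by
      convert h' using 1
      ext p q
      simp [leftAmp]

/-- The full transpose of (Λ⊗id)(ρ) is ((T∘Λ)⊗id) applied to the partial transpose of ρ, and
transposition preserves positivity. -/
theorem IsCompletelyCopositive.leftAmp_posSemidef [Fintype m] {Λ : SuperOp n}
    (h : IsCompletelyCopositive Λ) {ρ : Matrix (n × m) (n × m) ℂ}
    (hρ : (rightAmp n (transposeMap m) ρ).PosSemidef) :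
    (leftAmp m Λ ρ).PosSemidef := by
  have := (IsCompletelyPositive.leftAmp_posSemidef h hρ).transpose
  exact this

theorem IsDecomposable.leftAmp_posSemidef [Fintype m] {Λ : SuperOp n}
    (h : IsDecomposable Λ) {ρ : Matrix (n × m) (n × m) ℂ} (hρ : ρ.PosSemidef)
    (hρ' : (rightAmp n (transposeMap m) ρ).PosSemidef) :
    (leftAmp m Λ ρ).PosSemidef := by
  obtain ⟨Λ₁, Λ₂, h₁, h₂, rfl⟩ := h
  exact (h₁.leftAmp_posSemidef hρ).add (h₂.leftAmp_posSemidef hρ')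

theorem IsSeparable.leftAmp_posSemidef [Fintype n] [Fintype m] {Λ : SuperOp n}
    (h : IsPositiveMap Λ) {ρ : Matrix (n × m) (n × m) ℂ} (hρ : IsSeparable ρ) :
    (leftAmp m Λ ρ).PosSemidef := by
  obtain ⟨r, X, Y, hX, hY, rfl⟩ := hρ
  rw [map_sum]
  refine posSemidef_sum _ fun s _ => ?_
  rw [leftAmp_kronecker]
  exact (h _ (hX s)).kronecker (hY s)

/-- By cyclicity and Y² = Y, the trace is that of the positive operator Y X Yᴴ. -/
theorem trace_mul_nonneg_of_projection [Fintype m] {X Y : Matrix m m ℂ} (hX : X.PosSemidef)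
    (h : Y.IsHermitian) (h2 : Y * Y = Y) : 0 ≤ (X * Y).trace := by
  have := (hX.mul_mul_conjTranspose_same Y).trace_nonneg
  rwa [h.eq, Matrix.trace_mul_comm, ← mul_assoc, h2, Matrix.trace_mul_comm] at this

end General

/-! ### Positivity of the reduction-type map. -/

section Reduction

/-- For `X = Mᴴ N` of rank at most `card ι`, `|Tr X|² ≤ card ι · Tr (Xᴴ X)`. -/
theorem normSq_trace_conjTranspose_mul_le {ι κ : Type*} [Fintype ι] [DecidableEq ι] [Fintype κ]
    (M N : Matrix ι κ ℂ) :
    Complex.normSq (Mᴴ * N).trace ≤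
      Fintype.card ι * ((Nᴴ * (M * Mᴴ) * N).trace).re := by
  have hH : (M * Mᴴ).IsHermitian := isHermitian_mul_conjTranspose_self M
  obtain ⟨U, d, hUU, hUU', hspec⟩ : ∃ (U : Matrix ι ι ℂ) (d : ι → ℝ), U * Uᴴ = 1 ∧ Uᴴ * U = 1 ∧
      M * Mᴴ = U * diagonal (fun i => (d i : ℂ)) * Uᴴ := by
    refine ⟨hH.eigenvectorUnitary, hH.eigenvalues,
      (Unitary.mem_iff.mp hH.eigenvectorUnitary.2).2,
      (Unitary.mem_iff.mp hH.eigenvectorUnitary.2).1, ?_⟩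
    conv_lhs => rw [hH.spectral_theorem]
    simp [Unitary.conjStarAlgAut_apply, star_eq_conjTranspose, Function.comp_def]
  -- Rotating the rows by the eigenbasis of MMᴴ changes neither trace and makes the rows of `M'`
  -- orthogonal, with squared norms `d i`.
  set M' := Uᴴ * M with hM'
  set N' := Uᴴ * N with hN'
  have hD : M' * M'ᴴ = diagonal (fun i => (d i : ℂ)) := by
    rw [hM', conjTranspose_mul, conjTranspose_conjTranspose]
    calc Uᴴ * M * (Mᴴ * U) = Uᴴ * (M * Mᴴ) * U := by simp only [Matrix.mul_assoc]
      _ = (Uᴴ * U) * diagonal (fun i => (d i : ℂ)) * (Uᴴ * U) := by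
          rw [hspec]; simp only [Matrix.mul_assoc]
      _ = _ := by rw [hUU']; simp
  have h1 : Mᴴ * N = M'ᴴ * N' := by
    rw [hM', hN', conjTranspose_mul, conjTranspose_conjTranspose]
    calc Mᴴ * N = Mᴴ * (U * Uᴴ) * N := by rw [hUU]; simp
      _ = _ := by simp only [Matrix.mul_assoc]
  have h2 : Nᴴ * (M * Mᴴ) * N = N'ᴴ * (diagonal (fun i => (d i : ℂ))) * N' := by
    rw [hspec, hN', conjTranspose_mul, conjTranspose_conjTranspose]; simp only [Matrix.mul_assoc]
  have hDi : ∀ i, d i = ∑ j, ‖M' i j‖ ^ 2 := by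
    intro i
    have := congrFun (congrFun hD i) i
    rw [diagonal_apply_eq, Matrix.mul_apply] at this
    have h3 : ((d i : ℝ) : ℂ) = ((∑ j, ‖M' i j‖ ^ 2 : ℝ) : ℂ) := by
      rw [← this]; push_cast
      exact Finset.sum_congr rfl fun j _ => by
        rw [conjTranspose_apply]; exact Complex.mul_conj' _
    exact_mod_cast h3
  have h3 : ((Nᴴ * (M * Mᴴ) * N).trace).re =
      ∑ i, (∑ j, ‖M' i j‖ ^ 2) * ∑ j, ‖N' i j‖ ^ 2 := by
    rw [h2]
    have : (N'ᴴ * (diagonal (fun i => (d i : ℂ))) * N').trace =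
        ((∑ i, (∑ j, ‖M' i j‖ ^ 2) * ∑ j, ‖N' i j‖ ^ 2 : ℝ) : ℂ) := by
      rw [Matrix.trace]
      simp only [diag_apply, Matrix.mul_apply (M := _ * _), mul_diagonal, conjTranspose_apply]
      rw [Finset.sum_comm]
      push_cast
      refine Finset.sum_congr rfl fun i _ => ?_
      rw [Finset.mul_sum]
      refine Finset.sum_congr rfl fun j _ => ?_
      have := Complex.conj_mul' (N' i j)
      rw [← this, hDi i]
      push_cast
      simp only [Complex.star_def]
      ring
    rw [this, Complex.ofReal_re]
  have h4 : (Mᴴ * N).trace = ∑ i, ∑ j, star (M' i j) * N' i j := by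
    rw [h1, Matrix.trace, Finset.sum_comm]
    simp [Matrix.mul_apply]
  rw [h3, h4, Complex.normSq_eq_norm_sq]
  -- Cauchy–Schwarz is used twice: across the rows, which costs the factor `card ι`, and then inside
  -- each row.
  calc ‖∑ i, ∑ j, star (M' i j) * N' i j‖ ^ 2
      ≤ (∑ i, ‖∑ j, star (M' i j) * N' i j‖) ^ 2 := by
        gcongr; exact norm_sum_le _ _
    _ ≤ Fintype.card ι * ∑ i, ‖∑ j, star (M' i j) * N' i j‖ ^ 2 := sq_sum_le_card_mul_sum_sq
    _ ≤ Fintype.card ι * ∑ i, (∑ j, ‖M' i j‖ ^ 2) * ∑ j, ‖N' i j‖ ^ 2 := by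
        gcongr with i _
        calc ‖∑ j, star (M' i j) * N' i j‖ ^ 2 ≤ (∑ j, ‖M' i j‖ * ‖N' i j‖) ^ 2 := by
              gcongr
              refine (norm_sum_le _ _).trans (Finset.sum_le_sum fun j _ => ?_)
              rw [norm_mul, norm_star]
          _ ≤ _ := Finset.sum_mul_sq_le_sq_mul_sq _ _ _

variable (dA dB : ℕ)

theorem redMap_apply (X : Matrix (Fin dA × Fin dB) (Fin dA × Fin dB) ℂ) (p q : Fin dA × Fin dB) :
    redMap dA dB X p q =
      (if p.2 = q.2 then ∑ k, X (p.1, k) (q.1, k) else 0) - 1 / (dA : ℂ) * X p q := by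
  simp [redMap, tensorMap, leftAmp_id, rightAmp, oneTr, one_apply, Matrix.trace]

theorem redMap_vecMulVec_posSemidef (hA : 1 ≤ dA) (v : Fin dA × Fin dB → ℂ) :
    (redMap dA dB (vecMulVec v (star v))).PosSemidef := by
  refine PosSemidef.of_dotProduct_mulVec_nonneg ?_ fun x => ?_
  · ext p q
    simp only [conjTranspose_apply, redMap_apply, vecMulVec_apply, star_sub, star_mul',
      Pi.star_apply, star_star, apply_ite star, star_sum, star_zero, eq_comm (a := q.2)]
    congr 1
    · congr 1
      exact Finset.sum_congr rfl fun k _ => mul_comm _ _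
    · simp [mul_comm]
  · set M : Matrix (Fin dA) (Fin dB) ℂ := Matrix.of fun i j => v (i, j) with hM
    set N : Matrix (Fin dA) (Fin dB) ℂ := Matrix.of fun i j => x (i, j) with hN
    -- Reshaping `v` and `x` into dA × dB matrices turns the quadratic form into the two sides of
    -- the trace inequality.
    have key : star x ⬝ᵥ redMap dA dB (vecMulVec v (star v)) *ᵥ x =
        (Nᴴ * (M * Mᴴ) * N).trace -
          1 / (dA : ℂ) * (star (Mᴴ * N).trace * (Mᴴ * N).trace) := by
      simp only [dotProduct, mulVec, redMap_apply, vecMulVec_apply, sub_mul, mul_sub,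
        Finset.sum_sub_distrib]
      congr 1
      · simp only [Matrix.trace, diag_apply, Matrix.mul_apply, hM, hN, conjTranspose_apply,
          of_apply, Fintype.sum_prod_type, ite_mul, zero_mul, Finset.sum_ite_eq, Finset.mem_univ,
          if_true, Finset.mul_sum, Finset.sum_mul, Pi.star_apply]
        rw [Finset.sum_comm]
        refine Finset.sum_congr rfl fun j _ => ?_
        rw [Finset.sum_comm]
        refine Finset.sum_congr rfl fun i _ => Finset.sum_congr rfl fun i' _ =>
          Finset.sum_congr rfl fun k _ => ?_
        ring
      · have h1 : (Mᴴ * N).trace = ∑ p, star (v p) * x p := by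
          simp only [Matrix.trace, diag_apply, Matrix.mul_apply, hM, hN, conjTranspose_apply,
            of_apply, Fintype.sum_prod_type]
          rw [Finset.sum_comm]
        rw [h1, star_sum, Finset.sum_mul_sum, Finset.mul_sum]
        refine Finset.sum_congr rfl fun p _ => ?_
        rw [Finset.mul_sum, Finset.mul_sum]
        refine Finset.sum_congr rfl fun q _ => ?_
        simp only [star_mul', star_star, Pi.star_apply]
        ring
    have him : (Nᴴ * (M * Mᴴ) * N).trace = (((Nᴴ * (M * Mᴴ) * N).trace).re : ℂ) := by
      have h : (Nᴴ * (M * Mᴴ) * N).PosSemidef :=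
        (posSemidef_self_mul_conjTranspose M).conjTranspose_mul_mul_same N
      have := Complex.nonneg_iff.mp h.trace_nonneg
      exact Complex.ext rfl (by simp [← this.2])
    have hle := normSq_trace_conjTranspose_mul_le M N
    rw [key, him, Complex.star_def, ← Complex.normSq_eq_conj_mul_self]
    have hA' : (0 : ℝ) < dA := by exact_mod_cast hA
    have : 0 ≤ ((Nᴴ * (M * Mᴴ) * N).trace).re - 1 / (dA : ℝ) * Complex.normSq (Mᴴ * N).trace := by
      rw [Fintype.card_fin] at hle
      rw [sub_nonneg, one_div, inv_mul_le_iff₀ hA']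
      exact hle
    have h' := Complex.zero_le_real.mpr this
    simpa using h'

theorem redMap_isPositiveMap (hA : 1 ≤ dA) : IsPositiveMap (redMap dA dB) := by
  intro X hX
  obtain ⟨m, v, rfl⟩ := posSemidef_iff_eq_sum_vecMulVec.mp hX
  rw [map_sum]
  exact posSemidef_sum _ fun i _ => redMap_vecMulVec_posSemidef dA dB hA (v i)

end Reduction

/-! ### The operator R: positivity, PPT property, detection and Choi form. -/

section OpR

variable {dA dB : ℕ}

/-- This is the spectral form of R: only two of the four joint eigenspaces of the commuting
projectors survive. Positivity, the trace and the detection value are read off from it. -/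
theorem opR_eq_add : opR dA dB = pairTensor (1 - maxEnt (Fin dA)) (1 - maxEnt (Fin dB)) +
    (((dA - 1) * (dB + 1) : ℝ) : ℂ) • pairTensor (maxEnt (Fin dA)) (maxEnt (Fin dB)) := by
  simp only [opR, pairTensor_sub_left, pairTensor_sub_right, pairTensor_one_one]
  push_cast
  module

theorem opR_posSemidef (hA : 1 ≤ dA) (hB : 1 ≤ dB) : (opR dA dB).PosSemidef := by
  have : Nonempty (Fin dA) := ⟨⟨0, hA⟩⟩
  have : Nonempty (Fin dB) := ⟨⟨0, hB⟩⟩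
  rw [opR_eq_add]
  refine ((one_sub_maxEnt_posSemidef _).pairTensor (one_sub_maxEnt_posSemidef _)).add
    (((maxEnt_posSemidef _).pairTensor (maxEnt_posSemidef _)).smul ?_)
  rw [Complex.zero_le_real]
  have : (1 : ℝ) ≤ dA := by exact_mod_cast hA
  exact mul_nonneg (by linarith) (by positivity)

theorem trace_opR (hA : 1 ≤ dA) (hB : 1 ≤ dB) :
    (opR dA dB).trace =
      ((((dA : ℝ) ^ 2 - 1) * ((dB : ℝ) ^ 2 - 1) + (dA - 1) * (dB + 1) : ℝ) : ℂ) := by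
  have : Nonempty (Fin dA) := ⟨⟨0, hA⟩⟩
  have : Nonempty (Fin dB) := ⟨⟨0, hB⟩⟩
  rw [opR_eq_add, Matrix.trace_add, Matrix.trace_smul, trace_pairTensor, trace_pairTensor,
    trace_maxEnt, trace_maxEnt, Matrix.trace_sub, Matrix.trace_sub, trace_maxEnt, trace_maxEnt]
  simp
  ring

theorem trace_opR_pos (hA : 2 ≤ dA) (hB : 1 ≤ dB) : 0 < (opR dA dB).trace := by
  rw [trace_opR (by omega) hB, Complex.zero_lt_real]
  have h1 : (2 : ℝ) ≤ dA := by exact_mod_cast hA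
  have h2 : (1 : ℝ) ≤ dB := by exact_mod_cast hB
  have h3 : 0 ≤ ((dA : ℝ) ^ 2 - 1) * ((dB : ℝ) ^ 2 - 1) :=
    mul_nonneg (by nlinarith) (by nlinarith)
  have h4 : 0 < ((dA : ℝ) - 1) * (dB + 1) := mul_pos (by linarith) (by linarith)
  linarith

/-- The partial transpose is diagonal in the symmetric/antisymmetric sectors. The coefficient dA dB
- dB + dA in R is exactly the one that kills the (symmetric A, antisymmetric B) sector; the last
sector listed is the one whose sign compares dA with dB. -/
theorem rightAmp_transpose_opR (hA : 1 ≤ dA) (hB : 1 ≤ dB) :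
    rightAmp (Fin dA × Fin dB) (transposeMap (Fin dA × Fin dB)) (opR dA dB) =
      (((1 - 1 / dA) / 2 : ℝ) : ℂ) • pairTensor (1 + flipOp (Fin dA)) (1 + flipOp (Fin dB)) +
      (((1 + 1 / dB) / 2 : ℝ) : ℂ) • pairTensor (1 - flipOp (Fin dA)) (1 - flipOp (Fin dB)) +
      (((1 / dA - 1 / dB) / 2 : ℝ) : ℂ) • pairTensor (1 - flipOp (Fin dA)) (1 + flipOp (Fin dB)) := by
  have hA' : (dA : ℂ) ≠ 0 := by exact_mod_cast (by omega : dA ≠ 0)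
  have hB' : (dB : ℂ) ≠ 0 := by exact_mod_cast (by omega : dB ≠ 0)
  rw [opR, map_add, map_sub, map_sub, map_smul, rightAmp_transpose_one,
    rightAmp_transpose_pairTensor, rightAmp_transpose_pairTensor, rightAmp_transpose_pairTensor,
    rightAmp_transpose_one, rightAmp_transpose_one, rightAmp_transpose_maxEnt,
    rightAmp_transpose_maxEnt, ← pairTensor_one_one]
  simp only [pairTensor_sub_left, pairTensor_sub_right, pairTensor_add_left, pairTensor_add_right,
    pairTensor_smul_left, pairTensor_smul_right, Fintype.card_fin]
  push_cast
  match_scalars <;> field_simp <;> ring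

theorem opR_ppt (hA : 1 ≤ dA) (hAB : dA < dB) :
    (rightAmp (Fin dA × Fin dB) (transposeMap (Fin dA × Fin dB)) (opR dA dB)).PosSemidef := by
  have h1 : (1 : ℝ) ≤ dA := by exact_mod_cast hA
  have h2 : (dA : ℝ) < dB := by exact_mod_cast hAB
  rw [rightAmp_transpose_opR hA (by omega)]
  refine ((PosSemidef.smul ((one_add_flip_posSemidef _).pairTensor (one_add_flip_posSemidef _))
    ?_).add (PosSemidef.smul ((one_sub_flip_posSemidef _).pairTensor (one_sub_flip_posSemidef _))
    ?_)).add (PosSemidef.smul ((one_sub_flip_posSemidef _).pairTensor (one_add_flip_posSemidef _))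
    ?_)
  all_goals rw [Complex.zero_le_real]
  · have : 1 / (dA : ℝ) ≤ 1 := by rw [div_le_one (by linarith)]; exact h1
    linarith
  · positivity
  · have : 1 / (dB : ℝ) ≤ 1 / dA := one_div_le_one_div_of_le (by linarith) h2.le
    linarith

/-- The witness is the expectation in P_A⊗P_B. The map leaves the A side alone, so the term with
1-P_A contributes nothing, and the other term contributes (dA-1)(dB+1)(1/dB - 1/dA) < 0. -/
theorem redMap_detects_opR (hA : 2 ≤ dA) (hAB : dA < dB) :
    Detects (redMap dA dB) (opR dA dB) := by
  intro hpos
  have h1 : (2 : ℝ) ≤ dA := by exact_mod_cast hA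
  have h2 : (dA : ℝ) < dB := by exact_mod_cast hAB
  have : Nonempty (Fin dA) := ⟨⟨0, by omega⟩⟩
  have : Nonempty (Fin dB) := ⟨⟨0, by omega⟩⟩
  have hP : pairTensor (maxEnt (Fin dA)) (maxEnt (Fin dB)) *
      pairTensor (maxEnt (Fin dA)) (maxEnt (Fin dB)) =
      pairTensor (maxEnt (Fin dA)) (maxEnt (Fin dB)) := by
    rw [pairTensor_mul, maxEnt_mul_self, maxEnt_mul_self]
  have htr := trace_mul_nonneg_of_projection hpos
    ((maxEnt_posSemidef (Fin dA)).pairTensor (maxEnt_posSemidef (Fin dB))).isHermitian hP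
  have hval : (leftAmp (Fin dA × Fin dB) (redMap dA dB) (opR dA dB) *
      pairTensor (maxEnt (Fin dA)) (maxEnt (Fin dB))).trace =
      ((((dA - 1) * (dB + 1) : ℝ) * (1 / dB - 1 / dA : ℝ) : ℝ) : ℂ) := by
    have h : leftAmp (Fin dB) (oneTr (Fin dB) - (1 / (dA : ℂ)) • LinearMap.id) (maxEnt (Fin dB)) *
        maxEnt (Fin dB) = (1 / (dB : ℂ) - 1 / dA) • maxEnt (Fin dB) := by
      rw [leftAmp_sub, leftAmp_smul, leftAmp_id, LinearMap.sub_apply, leftAmp_oneTr_maxEnt,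
        LinearMap.smul_apply, LinearMap.id_apply, sub_mul, smul_mul_assoc, smul_mul_assoc,
        maxEnt_mul_self, one_mul, ← sub_smul, Fintype.card_fin]
    rw [opR_eq_add, redMap, map_add, map_smul, leftAmp_tensorMap_id_pairTensor,
      leftAmp_tensorMap_id_pairTensor, add_mul, smul_mul_assoc, pairTensor_mul, pairTensor_mul,
      h, sub_mul 1, maxEnt_mul_self, one_mul, sub_self, Matrix.trace_add, Matrix.trace_smul,
      trace_pairTensor, trace_pairTensor, Matrix.trace_smul, trace_maxEnt, trace_maxEnt]
    simp
  rw [hval, Complex.zero_le_real] at htr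
  have h3 : 1 / (dB : ℝ) < 1 / dA := one_div_lt_one_div_of_lt (by linarith) h2
  have h4 : 0 < ((dA : ℝ) - 1) * (dB + 1) := mul_pos (by linarith) (by linarith)
  nlinarith

theorem smul_choi_Phi (hA : 1 ≤ dA) (hB : 1 ≤ dB) (α β γ : ℝ) :
    ((dA : ℂ) * dB) • choi (Phi dA dB α β γ) =
      1 + ((α : ℂ) * dB) • pairTensor 1 (maxEnt (Fin dB)) +
        ((β : ℂ) * dA) • pairTensor (maxEnt (Fin dA)) 1 +
        ((γ : ℂ) * (dA * dB)) • pairTensor (maxEnt (Fin dA)) (maxEnt (Fin dB)) := by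
  have hA' : (dA : ℂ) ≠ 0 := by exact_mod_cast (by omega : dA ≠ 0)
  have hB' : (dB : ℂ) ≠ 0 := by exact_mod_cast (by omega : dB ≠ 0)
  have h1 := leftAmp_oneTr_maxEnt (Fin dA × Fin dB)
  rw [choi, Phi, leftAmp_add, leftAmp_add, leftAmp_add, leftAmp_smul, leftAmp_smul, leftAmp_smul,
    leftAmp_id]
  simp only [LinearMap.add_apply, LinearMap.smul_apply, LinearMap.id_apply, h1]
  rw [maxEnt_prod, leftAmp_tensorMap_id_pairTensor, leftAmp_tensorMap_pairTensor_id,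
    leftAmp_oneTr_maxEnt, leftAmp_oneTr_maxEnt, pairTensor_smul_left, pairTensor_smul_right]
  simp only [Fintype.card_prod, Fintype.card_fin, Nat.cast_mul]
  match_scalars
  all_goals field_simp

theorem opR_eq_choi (hA : 1 ≤ dA) (hB : 1 ≤ dB) :
    opR dA dB = ((dA : ℂ) * dB) •
      choi (Phi dA dB (-1 / dB) (-1 / dA) (1 - ((dB : ℝ) - dA) / (dA * dB))) := by
  have hA' : (dA : ℂ) ≠ 0 := by exact_mod_cast (by omega : dA ≠ 0)
  have hB' : (dB : ℂ) ≠ 0 := by exact_mod_cast (by omega : dB ≠ 0)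
  rw [smul_choi_Phi hA hB, opR]
  push_cast
  match_scalars <;> field_simp <;> ring

theorem opR_isPPTEntangledState (hA : 2 ≤ dA) (hAB : dA < dB) :
    IsPPTEntangledState ((opR dA dB).trace⁻¹ • opR dA dB) := by
  have hA1 : 1 ≤ dA := by omega
  have hpos : 0 < (opR dA dB).trace := trace_opR_pos hA (by omega)
  have hinv : 0 ≤ (opR dA dB).trace⁻¹ := inv_nonneg_of_nonneg hpos.le
  refine ⟨(opR_posSemidef hA1 (by omega)).smul hinv, ?_, ?_, fun h => ?_⟩
  · rw [Matrix.trace_smul, smul_eq_mul, inv_mul_cancel₀ hpos.ne']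
  · rw [map_smul]
    exact (opR_ppt hA1 hAB).smul hinv
  · have h' := (h.leftAmp_posSemidef (redMap_isPositiveMap dA dB hA1)).smul hpos.le
    rw [map_smul, smul_smul, mul_inv_cancel₀ hpos.ne', one_smul] at h'
    exact redMap_detects_opR hA hAB h'

end OpR

/-! ### Measure-and-prepare maps from product decompositions of the Choi operator. -/

section EntanglementBreaking

variable {n : Type*} [Fintype n] [DecidableEq n]

/-- The vector `φ ⊗ conj φ`. -/
def conjSquare (φ : n → ℂ) : n × n → ℂ := fun p => φ p.1 * star (φ p.2)

/-- Choi inversion: the block of `choi Λ` at ancilla indices `r`, `s` is the image of the matrix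
unit E_rs divided by the dimension, and linearity does the rest. -/
theorem apply_eq_sum_choi (Λ : SuperOp n) (X : Matrix n n ℂ) (p q : n) :
    Λ X p q = ∑ r, ∑ s, ((Fintype.card n : ℂ) • choi Λ) (p, r) (q, s) * X r s := by
  have hn : Nonempty n := ⟨p⟩
  have h : ∀ r s, ((Fintype.card n : ℂ) • choi Λ) (p, r) (q, s) * X r s =
      Λ (Matrix.single r s (X r s)) p q := by
    intro r s
    have h1 : X r s • (Matrix.of fun i j => maxEnt n (i, r) (j, s)) =
        (1 / (Fintype.card n : ℂ)) • Matrix.single r s (X r s) := by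
      ext i j
      simp [maxEnt_apply, Matrix.single_apply, eq_comm, mul_comm]
    have h2 : (1 / (Fintype.card n : ℂ)) • Λ (Matrix.single r s (X r s)) =
        X r s • Λ (Matrix.of fun i j => maxEnt n (i, r) (j, s)) := by
      rw [← map_smul, ← h1, map_smul]
    have h3 := congrFun (congrFun h2 p) q
    simp only [Matrix.smul_apply, smul_eq_mul] at h3 ⊢
    change (Fintype.card n : ℂ) * Λ (Matrix.of fun i j => maxEnt n (i, r) (j, s)) p q * X r s = _
    rw [mul_assoc, mul_comm (Λ _ p q), ← h3, ← mul_assoc]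
    simp
  simp only [h]
  conv_lhs => rw [matrix_eq_sum_single X]
  simp only [map_sum, Matrix.sum_apply]

/-- The conjugate in `conjSquare` makes Choi inversion read Λ(X) = ∑ c_k ⟨φ_k|X|φ_k⟩ |φ_k⟩⟨φ_k|:
measure, then prepare. -/
theorem isEntanglementBreaking_of_choi_eq_sum {Λ : SuperOp n} {κ : Type*} [Fintype κ]
    (c : κ → ℝ) (hc : ∀ k, 0 ≤ c k) (φ : κ → n → ℂ)
    (h : (Fintype.card n : ℂ) • choi Λ =
      ∑ k, c k • vecMulVec (conjSquare (φ k)) (star (conjSquare (φ k)))) :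
    IsEntanglementBreaking Λ := by
  intro d ρ hρ
  -- `B k` is |φ_k⟩⊗1, so Bᴴ ρ B is the unnormalised state of the ancilla conditioned on outcome k.
  let B : κ → Matrix (n × Fin d) (Fin d) ℂ := fun k =>
    Matrix.of fun p j => if p.2 = j then φ k p.1 else 0
  let e := Fintype.equivFin κ
  refine ⟨Fintype.card κ, fun s => vecMulVec (φ (e.symm s)) (star (φ (e.symm s))),
    fun s => ((c (e.symm s) : ℝ) : ℂ) • ((B (e.symm s))ᴴ * ρ * B (e.symm s)),
    fun s => posSemidef_vecMulVec_self_star _,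
    fun s => (hρ.conjTranspose_mul_mul_same _).smul (Complex.zero_le_real.mpr (hc _)), ?_⟩
  rw [Equiv.sum_comp e.symm (fun k => vecMulVec (φ k) (star (φ k)) ⊗ₖ
    (((c k : ℝ) : ℂ) • ((B k)ᴴ * ρ * B k)))]
  ext p q
  change Λ (Matrix.of fun i j => ρ (i, p.2) (j, q.2)) p.1 q.1 = _
  rw [apply_eq_sum_choi, h]
  have hB : ∀ k x y, ((B k)ᴴ * ρ * B k) x y =
      ∑ r, ∑ s, star (φ k r) * ρ (r, x) (s, y) * φ k s := by
    intro k x y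
    simp only [Matrix.mul_apply, B, conjTranspose_apply, of_apply, Fintype.sum_prod_type, mul_ite,
      mul_zero, apply_ite star, star_zero, ite_mul, zero_mul, Finset.sum_ite_eq',
      Finset.mem_univ, if_true, Finset.sum_mul]
    exact Finset.sum_comm
  simp only [Matrix.sum_apply, Matrix.smul_apply, vecMulVec_apply, conjSquare, Pi.star_apply,
    of_apply, kroneckerMap_apply, hB, Finset.sum_mul, Finset.mul_sum, smul_eq_mul,
    Complex.real_smul, star_mul', star_star]
  refine Eq.trans (Finset.sum_congr rfl fun r _ => ?_) Finset.sum_comm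
  refine Eq.trans (Finset.sum_congr rfl fun s _ => ?_) Finset.sum_comm
  refine Finset.sum_congr rfl fun k _ => ?_
  ring

end EntanglementBreaking

/-! ### Compactness of convex hulls. -/

/-- In finite dimension, the convex hull of a compact set is compact. -/
theorem isCompact_convexHull_of_finiteDimensional {E : Type*} [AddCommGroup E] [Module ℝ E]
    [FiniteDimensional ℝ E] [TopologicalSpace E] [ContinuousAdd E] [ContinuousSMul ℝ E]
    {s : Set E} (hs : IsCompact s) : IsCompact (convexHull ℝ s) := by
  rcases s.eq_empty_or_nonempty with rfl | ⟨s₀, hs₀⟩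
  · simp
  set N := Module.finrank ℝ E + 1
  let f : (Fin N → ℝ) × (Fin N → E) → E := fun x => ∑ i, x.1 i • x.2 i
  have hf : Continuous f := by fun_prop
  have hcomp : IsCompact (stdSimplex ℝ (Fin N) ×ˢ Set.univ.pi fun _ : Fin N => s) :=
    (isCompact_stdSimplex ℝ _).prod (isCompact_univ_pi fun _ => hs)
  convert hcomp.image hf
  apply Set.Subset.antisymm
  · intro x hx
    -- Carathéodory: affinely independent points suffice, hence at most `finrank + 1` of them.
    obtain ⟨ι, _, z, w, hz, hind, hw, hw1, rfl⟩ := eq_pos_convex_span_of_mem_convexHull hx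
    have hcard : Fintype.card ι ≤ Fintype.card (Fin N) := by
      rw [Fintype.card_fin]
      exact hind.card_le_finrank_succ.trans (Nat.succ_le_succ (Submodule.finrank_le _))
    obtain ⟨e⟩ := Function.Embedding.nonempty_of_card_le hcard
    have hext : ∀ j, j ∉ Set.range e → Function.extend e w 0 j = 0 := fun j hj =>
      Function.extend_apply' _ _ _ hj
    -- The unused slots get weight 0 and the dummy point `s₀`, which keeps every slot in `s`.
    refine ⟨(Function.extend e w 0, Function.extend e z fun _ => s₀), ⟨⟨fun j => ?_, ?_⟩, ?_⟩, ?_⟩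
    · by_cases hj : j ∈ Set.range e
      · obtain ⟨i, rfl⟩ := hj
        exact ((hw i).le).trans_eq (e.injective.extend_apply w 0 i).symm
      · exact (hext j hj).ge
    · rw [← hw1]
      exact (Fintype.sum_of_injective e e.injective _ _ hext
        fun i => (e.injective.extend_apply _ _ _).symm).symm
    · intro j _
      by_cases hj : j ∈ Set.range e
      · obtain ⟨i, rfl⟩ := hj
        change Function.extend e z (fun _ => s₀) (e i) ∈ s
        rw [e.injective.extend_apply]
        exact hz ⟨i, rfl⟩
      · change Function.extend e z (fun _ => s₀) j ∈ s
        rw [Function.extend_apply' _ _ _ hj]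
        exact hs₀
    · refine (Fintype.sum_of_injective e e.injective _ _ (fun j hj => ?_) fun i => ?_).symm
      · simp only [hext j hj, zero_smul]
      · simp only [e.injective.extend_apply]
  · rintro _ ⟨⟨w, z⟩, ⟨hw, hz⟩, rfl⟩
    exact (convex_convexHull ℝ s).sum_mem (fun i _ => hw.1 i) hw.2
      fun i _ => subset_convexHull ℝ s (hz i trivial)

/-! ### Tensors invariant under one unitary group. -/

section Commutant

variable {ι E : Type*} [Fintype ι] [DecidableEq ι] [AddCommGroup E] [Module ℂ E]

/-- A vector-valued four-index tensor is invariant under the action of a matrix `U` as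
`U ⊗ conj U ⊗ conj U ⊗ U`. -/
def IsInvariantTensor (U : Matrix ι ι ℂ) (T : ι → ι → ι → ι → E) : Prop :=
  ∀ p r q s, T p r q s = ∑ p', ∑ r', ∑ q', ∑ s',
    (U p p' * star (U r r') * star (U q q') * U s s') • T p' r' q' s'

theorem IsInvariantTensor.diagonal_apply {z : ι → ℂ} {T : ι → ι → ι → ι → E}
    (h : IsInvariantTensor (diagonal z) T) (p r q s : ι) :
    T p r q s = (z p * star (z r) * star (z q) * z s) • T p r q s := by
  conv_lhs => rw [h p r q s]
  rw [Fintype.sum_eq_single p, Fintype.sum_eq_single r, Fintype.sum_eq_single q,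
    Fintype.sum_eq_single s]
  · simp
  all_goals intro x hx; simp [diagonal_apply_ne' _ hx]

theorem IsInvariantTensor.perm_apply {σ : Equiv.Perm ι} {T : ι → ι → ι → ι → E}
    (h : IsInvariantTensor (Matrix.of fun i j => if σ i = j then (1 : ℂ) else 0) T)
    (p r q s : ι) : T p r q s = T (σ p) (σ r) (σ q) (σ s) := by
  rw [h p r q s, Fintype.sum_eq_single (σ p), Fintype.sum_eq_single (σ r),
    Fintype.sum_eq_single (σ q), Fintype.sum_eq_single (σ s)]
  · simp
  all_goals intro x hx; simp [hx.symm]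

/-- The phase is I rather than -1 because the pattern p = s, q = r must also be excluded: there the
phases multiply to I² = -1, whereas a sign would square to 1. -/
theorem isUnitary_diagonal_I (k : ι) :
    diagonal (fun i => if i = k then Complex.I else 1) *
      (diagonal (fun i => if i = k then Complex.I else 1))ᴴ = (1 : Matrix ι ι ℂ) := by
  rw [diagonal_conjTranspose, diagonal_mul_diagonal, ← diagonal_one]
  congr 1
  ext i
  by_cases hi : i = k <;> simp [hi]

theorem isUnitary_perm (σ : Equiv.Perm ι) :
    (Matrix.of fun i j => if σ i = j then (1 : ℂ) else 0) *
      (Matrix.of fun i j => if σ i = j then (1 : ℂ) else 0)ᴴ = 1 := by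
  ext i j
  simp [Matrix.mul_apply, one_apply, eq_comm]

/-- A rotation mixing the basis vectors `i` and `j`. -/
noncomputable def rot (i j : ι) : Matrix ι ι ℂ := Matrix.of fun x y =>
  -- The pair 3/5, 4/5 is a rational point of the unit circle with both coordinates nonzero.
  if x = i then (if y = i then 3 / 5 else if y = j then 4 / 5 else 0)
  else if x = j then (if y = i then -4 / 5 else if y = j then 3 / 5 else 0)
  else if x = y then 1 else 0

theorem isUnitary_rot {i j : ι} (hij : i ≠ j) : rot i j * (rot i j)ᴴ = 1 := by
  have hs : ∀ (g : ι → ℂ) (u v : ℂ), ∑ y, (if y = i then u else if y = j then v else 0) * g y =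
      u * g i + v * g j := by
    intro g u v
    rw [← Finset.sum_subset (Finset.subset_univ {i, j}), Finset.sum_pair hij]
    · simp [hij.symm]
    · intro x _ hx
      simp only [Finset.mem_insert, Finset.mem_singleton, not_or] at hx
      simp [hx.1, hx.2]
  ext x y
  rw [Matrix.mul_apply]
  simp only [conjTranspose_apply]
  by_cases hxi : x = i
  · subst hxi
    have : ∀ k, rot x j x k = if k = x then 3 / 5 else if k = j then 4 / 5 else 0 := by
      intro k; simp [rot]
    simp only [this, hs]
    by_cases hyi : y = x
    · subst hyi; simp [rot, hij.symm]; norm_num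
    · by_cases hyj : y = j
      · subst hyj; simp [rot, hij, hij.symm]; norm_num
      · simp [rot, hyi, hyj, Ne.symm hyi]
  · by_cases hxj : x = j
    · subst hxj
      have : ∀ k, rot i x x k = if k = i then -4 / 5 else if k = x then 3 / 5 else 0 := by
        intro k; simp [rot, hij.symm]
      simp only [this, hs]
      by_cases hyi : y = i
      · subst hyi; simp [rot, hij.symm]; norm_num
      · by_cases hyj : y = x
        · subst hyj; simp [rot, hij.symm]; norm_num
        · simp [rot, hyi, hyj, Ne.symm hyj]
    · have : ∀ k, rot i j x k = if x = k then 1 else 0 := by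
        intro k; simp [rot, hxi, hxj]
      simp only [this, ite_mul, one_mul, zero_mul, Finset.sum_ite_eq, Finset.mem_univ, if_true]
      by_cases hyi : y = i
      · subst hyi; simp [rot, hxi, hxj]
      · by_cases hyj : y = j
        · subst hyj; simp [rot, hxi, hxj, hyi]
        · simp [rot, hyi, hyj, one_apply, eq_comm (a := y)]

/-- A tensor invariant under all unitaries vanishes unless its indices pair up. -/
theorem eq_zero_of_invariant {T : ι → ι → ι → ι → E}
    (h : ∀ U : Matrix ι ι ℂ, U * Uᴴ = 1 → IsInvariantTensor U T) {p r q s : ι}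
    (h1 : ¬ (p = q ∧ r = s)) (h2 : ¬ (p = r ∧ q = s)) : T p r q s = 0 := by
  have key : ∀ {c : ℂ}, T p r q s = c • T p r q s → c ≠ 1 → T p r q s = 0 := by
    intro c hc hne
    have : (1 - c) • T p r q s = 0 := by rw [sub_smul, ← hc, one_smul, sub_self]
    exact (smul_eq_zero.mp this).resolve_left (sub_ne_zero.mpr hne.symm)
  have hp := (h _ (isUnitary_diagonal_I p)).diagonal_apply p r q s
  have hs := (h _ (isUnitary_diagonal_I s)).diagonal_apply p r q s
  have hI : Complex.I ≠ 1 := fun h => by simpa using congrArg Complex.re h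
  have hI' : -Complex.I ≠ 1 := fun h => by simpa using congrArg Complex.re h
  have hm : (-1 : ℂ) ≠ 1 := by norm_num
  -- The phase at `p` decides every case except s ≠ p with exactly one of `r`, `q` equal to `p`;
  -- there the phase at `s` does.
  by_cases hsp : s = p
  · subst hsp
    refine key hp ?_
    by_cases hr : r = s
    · have hq : ¬ q = s := fun hq => h2 ⟨hr.symm, hq⟩
      simp [hr, hq, hI]
    · by_cases hq : q = s <;> simp [hr, hq, hI, hm]
  · by_cases hr : r = p
    · by_cases hq : q = p
      · refine key hp ?_
        simp [hr, hq, hsp, hI']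
      · refine key hs ?_
        have : ¬ q = s := fun hqs => h2 ⟨hr.symm, hqs⟩
        simp [hr, Ne.symm hsp, this, hI]
    · by_cases hq : q = p
      · refine key hs ?_
        have : ¬ r = s := fun hrs => h1 ⟨hq.symm, hrs⟩
        simp [hq, Ne.symm hsp, this, hI]
      · refine key hp ?_
        simp [hr, hq, hsp, hI]

omit [Fintype ι] in
theorem exists_perm_map_pair {i j i' j' : ι} (h : i ≠ j) (h' : i' ≠ j') :
    ∃ σ : Equiv.Perm ι, σ i = i' ∧ σ j = j' := by
  refine ⟨Equiv.swap (Equiv.swap i i' j) j' * Equiv.swap i i', ?_, by simp⟩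
  rw [Equiv.Perm.mul_apply, Equiv.swap_apply_left]
  refine Equiv.swap_apply_of_ne_of_ne ?_ h'
  intro h2
  have : Equiv.swap i i' i = Equiv.swap i i' j := by rw [Equiv.swap_apply_left]; exact h2
  exact h ((Equiv.swap i i').injective this)

/-- The tensors invariant under `U ⊗ conj U ⊗ conj U ⊗ U` for all unitary `U`. -/
theorem exists_eq_of_invariant {T : ι → ι → ι → ι → E} (S : Submodule ℂ E)
    (hS : ∀ p r q s, T p r q s ∈ S)
    (h : ∀ U : Matrix ι ι ℂ, U * Uᴴ = 1 → IsInvariantTensor U T) :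
    ∃ α ∈ S, ∃ β ∈ S, ∀ p r q s, T p r q s =
      (if p = q ∧ r = s then α else 0) + (if p = r ∧ q = s then β else 0) := by
  rcases isEmpty_or_nonempty ι with hι | ⟨⟨o⟩⟩
  · exact ⟨0, S.zero_mem, 0, S.zero_mem, fun p => isEmptyElim p⟩
  rcases subsingleton_or_nontrivial ι with hι | hι
  · refine ⟨T o o o o, hS _ _ _ _, 0, S.zero_mem, fun p r q s => ?_⟩
    simp [Subsingleton.elim p o, Subsingleton.elim r o, Subsingleton.elim q o,
      Subsingleton.elim s o]
  obtain ⟨i, j, hij⟩ := exists_pair_ne ι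
  have hperm : ∀ (σ : Equiv.Perm ι) p r q s, T p r q s = T (σ p) (σ r) (σ q) (σ s) :=
    fun σ => (h _ (isUnitary_perm σ)).perm_apply
  have hα : ∀ k l, k ≠ l → T k l k l = T i j i j := fun k l hkl => by
    obtain ⟨σ, rfl, rfl⟩ := exists_perm_map_pair hij hkl
    exact (hperm σ _ _ _ _).symm
  have hβ : ∀ k l, k ≠ l → T k k l l = T i i j j := fun k l hkl => by
    obtain ⟨σ, rfl, rfl⟩ := exists_perm_map_pair hij hkl
    exact (hperm σ _ _ _ _).symm
  have hdiag : ∀ k, T k k k k = T i i i i := fun k => by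
    rw [hperm (Equiv.swap k i), Equiv.swap_apply_left]
  -- Phases and permutations leave the value at four equal indices free; a genuine rotation ties it
  -- to the two pairings.
  have hsum : T i i i i = T i j i j + T i i j j := by
    have hrot := h _ (isUnitary_rot hij) i i i i
    have hs : ∀ g : ι → E, ∑ y, rot i j i y • g y = (3 / 5 : ℂ) • g i + (4 / 5 : ℂ) • g j := by
      intro g
      rw [← Finset.sum_subset (Finset.subset_univ {i, j}), Finset.sum_pair hij]
      · simp [rot, hij.symm]
      · intro x _ hx
        simp only [Finset.mem_insert, Finset.mem_singleton, not_or] at hx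
        simp [rot, hx.1, hx.2]
    have hstar : ∀ y, star (rot i j i y) = rot i j i y := by
      intro y
      by_cases h1 : y = i
      · simp [rot, h1]
      · by_cases h2 : y = j
        · simp [rot, h2, hij.symm]
        · simp [rot, h1, h2]
    have hz : ∀ p r q s, ¬ (p = q ∧ r = s) → ¬ (p = r ∧ q = s) → T p r q s = 0 :=
      fun _ _ _ _ => eq_zero_of_invariant h
    simp only [hstar, mul_smul, ← Finset.smul_sum, hs, hdiag j, hα j i hij.symm, hβ j i hij.symm]
      at hrot
    rw [hz i i i j, hz i i j i, hz i j i i, hz i j j i, hz i j j j, hz j i i i, hz j i i j,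
      hz j i j j, hz j j i j, hz j j j i] at hrot
    -- With a = 3/5 and b = 4/5, the relation is multiplied by 1 - a⁴ - b⁴ = 2a²b² = 288/625.
    · linear_combination (norm := module) (625 / 288 : ℂ) • hrot
    all_goals simp [hij, hij.symm]
  refine ⟨T i j i j, hS _ _ _ _, T i i j j, hS _ _ _ _, fun p r q s => ?_⟩
  by_cases h1 : p = q ∧ r = s
  · obtain ⟨rfl, rfl⟩ := h1
    by_cases h2 : p = r
    · subst h2
      simp [hdiag, hsum]
    · simp [h2, hα p r h2]
  · by_cases h2 : p = r ∧ q = s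
    · obtain ⟨rfl, rfl⟩ := h2
      have : p ≠ q := fun h => h1 ⟨h, h⟩
      simp [this, hβ p q this]
    · rw [if_neg h1, if_neg h2, add_zero]
      exact eq_zero_of_invariant h h1 h2

end Commutant

/-! ### Local unitary symmetry, coisometry states and nearest points. -/

section Twirl

variable {a b : Type*} [Fintype a] [DecidableEq a] [Fintype b] [DecidableEq b]

omit [DecidableEq a] [DecidableEq b] in
theorem sum_prod_prod_comm (f : (a × b) × (a × b) → ℂ) :
    ∑ x, f x = ∑ u : a × a, ∑ w : b × b, f ((u.1, w.1), (u.2, w.2)) := by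
  rw [← Fintype.sum_prod_type']
  exact Fintype.sum_equiv (Equiv.prodProdProdComm a b a b) _ _ fun _ => rfl

omit [DecidableEq a] [DecidableEq b] in
theorem conj_pairTensor_apply (X : Matrix (a × a) (a × a) ℂ) (Y : Matrix (b × b) (b × b) ℂ)
    (D : Matrix ((a × b) × (a × b)) ((a × b) × (a × b)) ℂ) (p q : (a × b) × (a × b)) :
    (pairTensor X Y * D * (pairTensor X Y)ᴴ) p q = ∑ u : a × a, ∑ w : b × b, ∑ u' : a × a,
      ∑ w' : b × b, X (p.1.1, p.2.1) u * Y (p.1.2, p.2.2) w *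
        D ((u.1, w.1), (u.2, w.2)) ((u'.1, w'.1), (u'.2, w'.2)) *
          (star (X (q.1.1, q.2.1) u') * star (Y (q.1.2, q.2.2) w')) := by
  simp only [Matrix.mul_apply, Finset.sum_mul]
  rw [Finset.sum_comm, sum_prod_prod_comm]
  refine Finset.sum_congr rfl fun u _ => Finset.sum_congr rfl fun w _ => ?_
  rw [sum_prod_prod_comm]
  simp only [pairTensor_apply, conjTranspose_apply, star_mul']

/-- The unnormalised maximally entangled operator. -/
def omega (n : Type*) [DecidableEq n] : Matrix (n × n) (n × n) ℂ :=
  Matrix.of fun p q => if p.1 = p.2 ∧ q.1 = q.2 then 1 else 0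

theorem maxEnt_eq_smul_omega (n : Type*) [Fintype n] [DecidableEq n] :
    maxEnt n = (1 / (Fintype.card n : ℂ)) • omega n := by
  ext p q
  simp [maxEnt_apply, omega]

theorem omega_isHermitian (n : Type*) [DecidableEq n] : (omega n).IsHermitian := by
  ext p q
  simp [omega, and_comm]

theorem omega_mul_self (n : Type*) [Fintype n] [DecidableEq n] :
    omega n * omega n = (Fintype.card n : ℂ) • omega n := by
  ext p q
  by_cases h1 : p.1 = p.2 <;> by_cases h2 : q.1 = q.2 <;>
    simp [Matrix.mul_apply, omega, Fintype.sum_prod_type, h1, h2]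

theorem trace_omega (n : Type*) [Fintype n] [DecidableEq n] :
    (omega n).trace = Fintype.card n := by
  simp only [Matrix.trace, diag_apply, omega, of_apply, and_self, Fintype.sum_prod_type]
  simp

/-- The matrix `U ⊗ conj U`. -/
def conjDouble {n : Type*} (U : Matrix n n ℂ) : Matrix (n × n) (n × n) ℂ := U ⊗ₖ U.map star

theorem conjDouble_apply {n : Type*} (U : Matrix n n ℂ) (p q : n × n) :
    conjDouble U p q = U p.1 q.1 * star (U p.2 q.2) := rfl

theorem conjDouble_one {n : Type*} [DecidableEq n] : conjDouble (1 : Matrix n n ℂ) = 1 := by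
  rw [conjDouble, Matrix.map_one _ (star_zero _) (star_one _), one_kronecker_one]

theorem conjDouble_mul_conjTranspose {n : Type*} [Fintype n] [DecidableEq n] {U : Matrix n n ℂ}
    (hU : U * Uᴴ = 1) : conjDouble U * (conjDouble U)ᴴ = 1 := by
  have h : U.map star * (U.map star)ᴴ = 1 := by
    have := congrArg (fun X : Matrix n n ℂ => X.map star) hU
    simp only [Matrix.map_one _ (star_zero ℂ) (star_one ℂ)] at this
    rw [← this]
    ext i j
    simp [Matrix.mul_apply]
  rw [conjDouble, conjTranspose_kronecker, ← mul_kronecker_mul, hU, h, one_kronecker_one]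

/-- The coefficients of (U⊗conj U) ∑|ii⟩ are the entries of UUᴴ. -/
theorem conjDouble_mul_omega {n : Type*} [Fintype n] [DecidableEq n] {U : Matrix n n ℂ}
    (hU : U * Uᴴ = 1) : conjDouble U * omega n = omega n := by
  ext p q
  have := congrFun (congrFun hU p.1) p.2
  rw [Matrix.mul_apply] at this
  simp only [conjTranspose_apply] at this
  by_cases h : q.1 = q.2
  · simp [Matrix.mul_apply, conjDouble_apply, omega, Fintype.sum_prod_type, h]
    simpa [one_apply] using this
  · simp [Matrix.mul_apply, omega, h]

theorem conjDouble_conj_omega {n : Type*} [Fintype n] [DecidableEq n] {U : Matrix n n ℂ}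
    (hU : U * Uᴴ = 1) : conjDouble U * omega n * (conjDouble U)ᴴ = omega n := by
  have h := congrArg conjTranspose (conjDouble_mul_omega hU)
  rw [conjTranspose_mul, (omega_isHermitian n).eq] at h
  rw [conjDouble_mul_omega hU, h]

omit [Fintype a] [DecidableEq a] [Fintype b] [DecidableEq b] in
theorem conjTranspose_pairTensor (X : Matrix (a × a) (a × a) ℂ) (Y : Matrix (b × b) (b × b) ℂ) :
    (pairTensor X Y)ᴴ = pairTensor Xᴴ Yᴴ := by
  ext p q
  simp [pairTensor_apply]

omit [DecidableEq a] [DecidableEq b] in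
theorem pairTensor_conj (G X : Matrix (a × a) (a × a) ℂ) (H Y : Matrix (b × b) (b × b) ℂ) :
    pairTensor G H * pairTensor X Y * (pairTensor G H)ᴴ =
      pairTensor (G * X * Gᴴ) (H * Y * Hᴴ) := by
  rw [conjTranspose_pairTensor, pairTensor_mul, pairTensor_mul]

/-- The rank-one operators `(φ ⊗ conj φ)(φ ⊗ conj φ)ᴴ`, for `φ` the vector of a coisometry. -/
def coisometryStates (a b : Type*) [DecidableEq a] [Fintype b] :
    Set (Matrix ((a × b) × (a × b)) ((a × b) × (a × b)) ℂ) :=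
  (fun M : Matrix a b ℂ => vecMulVec (conjSquare fun p : a × b => M p.1 p.2)
    (star (conjSquare fun p : a × b => M p.1 p.2))) '' {M | M * Mᴴ = 1}

omit [Fintype a] [DecidableEq b] in
theorem isCompact_coisometryStates : IsCompact (coisometryStates a b) := by
  have hcl : IsClosed {M : Matrix a b ℂ | M * Mᴴ = 1} :=
    isClosed_eq (continuous_id.matrix_mul continuous_id.matrix_conjTranspose) continuous_const
  have hK : IsCompact {M : Matrix a b ℂ | M * Mᴴ = 1} := by
    refine IsCompact.of_isClosed_subset (isCompact_univ_pi fun _ : a => isCompact_univ_pi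
      fun _ : b => isCompact_closedBall (0 : ℂ) 1) hcl ?_
    intro M hM i _ j _
    rw [mem_closedBall_zero_iff]
    have h := congrFun (congrFun hM i) i
    rw [Matrix.mul_apply, one_apply_eq] at h
    -- The rows of a coisometry are unit vectors, which bounds every entry by 1.
    have h2 : ∑ j, ‖M i j‖ ^ 2 = 1 := by
      have h3 : ((∑ j, ‖M i j‖ ^ 2 : ℝ) : ℂ) = 1 := by
        rw [← h]; push_cast
        exact Finset.sum_congr rfl fun j _ => (Complex.mul_conj' _).symm
      exact_mod_cast h3
    have h4 := Finset.single_le_sum (f := fun j => ‖M i j‖ ^ 2) (fun j _ => by positivity)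
      (Finset.mem_univ j)
    rw [h2] at h4
    exact (sq_le_one_iff₀ (norm_nonneg _)).mp h4
  refine hK.image ?_
  refine continuous_matrix fun p q => ?_
  simp only [vecMulVec_apply, conjSquare, Pi.star_apply]
  fun_prop

/-- On matrices, U⊗V acts by M ↦ U M Vᵀ, which preserves coisometries. -/
theorem conj_mem_coisometryStates {U : Matrix a a ℂ} {V : Matrix b b ℂ} (hU : U * Uᴴ = 1)
    (hV : V * Vᴴ = 1) {W : Matrix ((a × b) × (a × b)) ((a × b) × (a × b)) ℂ}
    (hW : W ∈ coisometryStates a b) :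
    pairTensor (conjDouble U) (conjDouble V) * W * (pairTensor (conjDouble U) (conjDouble V))ᴴ ∈
      coisometryStates a b := by
  obtain ⟨M, hM, rfl⟩ := hW
  refine ⟨U * M * Vᵀ, ?_, ?_⟩
  · have hV' : Vᵀ * Vᵀᴴ = 1 := by
      have h1 : Vᴴ * V = 1 := mul_eq_one_comm.mp hV
      have := congrArg transpose h1
      rw [transpose_mul, transpose_one] at this
      exact this
    change U * M * Vᵀ * (U * M * Vᵀ)ᴴ = 1
    rw [conjTranspose_mul, conjTranspose_mul]
    calc U * M * Vᵀ * (Vᵀᴴ * (Mᴴ * Uᴴ)) = U * M * (Vᵀ * Vᵀᴴ) * (Mᴴ * Uᴴ) := by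
          simp only [Matrix.mul_assoc]
      _ = U * (M * Mᴴ) * Uᴴ := by rw [hV', Matrix.mul_one]; simp only [Matrix.mul_assoc]
      _ = 1 := by rw [show M * Mᴴ = 1 from hM, Matrix.mul_one, hU]
  · have key : pairTensor (conjDouble U) (conjDouble V) *ᵥ
        (conjSquare fun p : a × b => M p.1 p.2) =
        conjSquare fun p : a × b => (U * M * Vᵀ) p.1 p.2 := by
      ext ⟨⟨p₁, p₂⟩, ⟨r₁, r₂⟩⟩
      have h : ∀ i j, (U * M * Vᵀ) i j = ∑ x : a × b, U i x.1 * V j x.2 * M x.1 x.2 := by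
        intro i j
        rw [Fintype.sum_prod_type, Finset.sum_comm]
        simp only [Matrix.mul_apply, Finset.sum_mul, transpose_apply]
        exact Finset.sum_congr rfl fun _ _ => Finset.sum_congr rfl fun _ _ => by ring
      simp only [mulVec, dotProduct, conjSquare, pairTensor_apply, conjDouble_apply, h, star_sum,
        Finset.sum_mul_sum]
      rw [Fintype.sum_prod_type]
      refine Finset.sum_congr rfl fun x _ => Finset.sum_congr rfl fun y _ => ?_
      simp only [star_mul']
      ring
    change vecMulVec _ _ = _
    rw [mul_vecMulVec, vecMulVec_mul, key, ← star_mulVec, key]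

theorem conj_mem_convexHull {ι : Type*} [Fintype ι] {G : Matrix ι ι ℂ}
    {K : Set (Matrix ι ι ℂ)} (hG : ∀ W ∈ K, G * W * Gᴴ ∈ K) {W : Matrix ι ι ℂ}
    (hW : W ∈ convexHull ℝ K) : G * W * Gᴴ ∈ convexHull ℝ K := by
  have hlin : IsLinearMap ℝ fun W : Matrix ι ι ℂ => G * W * Gᴴ :=
    ⟨fun x y => by rw [mul_add, add_mul], fun c x => by rw [mul_smul_comm, smul_mul_assoc]⟩
  have h : convexHull ℝ K ⊆ (fun W => G * W * Gᴴ) ⁻¹' convexHull ℝ K :=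
    convexHull_min (fun W hW => subset_convexHull ℝ K (hG W hW))
      ((convex_convexHull ℝ K).is_linear_preimage hlin)
  exact h hW

/-- The squared Frobenius norm. -/
noncomputable def frobSq {ι : Type*} [Fintype ι] (D : Matrix ι ι ℂ) : ℝ := ∑ x, ∑ y, ‖D x y‖ ^ 2

theorem ofReal_frobSq {ι : Type*} [Fintype ι] (D : Matrix ι ι ℂ) :
    (frobSq D : ℂ) = (D * Dᴴ).trace := by
  simp only [frobSq, Matrix.trace, diag_apply, Matrix.mul_apply, conjTranspose_apply,
    Complex.ofReal_sum]
  refine Finset.sum_congr rfl fun x _ => Finset.sum_congr rfl fun y _ => ?_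
  rw [Complex.star_def, Complex.mul_conj']
  simp

theorem frobSq_conj {ι : Type*} [Fintype ι] [DecidableEq ι] {G : Matrix ι ι ℂ} (hG : G * Gᴴ = 1)
    (D : Matrix ι ι ℂ) : frobSq (G * D * Gᴴ) = frobSq D := by
  have hG' : Gᴴ * G = 1 := mul_eq_one_comm.mp hG
  have h : (G * D * Gᴴ) * (G * D * Gᴴ)ᴴ = G * (D * Dᴴ) * Gᴴ := by
    rw [conjTranspose_mul, conjTranspose_mul, conjTranspose_conjTranspose]
    calc G * D * Gᴴ * (G * (Dᴴ * Gᴴ)) = G * D * (Gᴴ * G) * (Dᴴ * Gᴴ) := by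
          simp only [Matrix.mul_assoc]
      _ = _ := by rw [hG', Matrix.mul_one]; simp only [Matrix.mul_assoc]
  have : (frobSq (G * D * Gᴴ) : ℂ) = frobSq D := by
    rw [ofReal_frobSq, ofReal_frobSq, h, Matrix.trace_mul_comm, ← Matrix.mul_assoc, hG',
      Matrix.one_mul]
  exact_mod_cast this

theorem eq_zero_of_frobSq_le_zero {ι : Type*} [Fintype ι] {D : Matrix ι ι ℂ}
    (h : frobSq D ≤ 0) : D = 0 := by
  have h0 : frobSq D = 0 := le_antisymm h
    (Finset.sum_nonneg fun _ _ => Finset.sum_nonneg fun _ _ => by positivity)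
  have : (D * Dᴴ).trace = 0 := by rw [← ofReal_frobSq, h0]; simp
  exact trace_mul_conjTranspose_self_eq_zero_iff.mp this

theorem frobSq_parallelogram {ι : Type*} [Fintype ι] (D D' : Matrix ι ι ℂ) :
    frobSq ((1 / 2 : ℝ) • D + (1 / 2 : ℝ) • D') + 1 / 4 * frobSq (D - D') =
      (frobSq D + frobSq D') / 2 := by
  simp only [frobSq, Finset.mul_sum, ← Finset.sum_add_distrib, Finset.sum_div]
  refine Finset.sum_congr rfl fun x _ => Finset.sum_congr rfl fun y _ => ?_
  simp only [← Complex.normSq_eq_norm_sq, Complex.normSq_apply, Matrix.add_apply,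
    Matrix.sub_apply, Matrix.smul_apply, Complex.add_re, Complex.add_im, Complex.sub_re,
    Complex.sub_im, Complex.smul_re, Complex.smul_im, smul_eq_mul]
  ring

/-- A compact convex set contains a unique point closest to a given one. -/
theorem exists_forall_frobSq_eq {ι : Type*} [Fintype ι] {C : Set (Matrix ι ι ℂ)}
    (hcomp : IsCompact C) (hconv : Convex ℝ C) (hne : C.Nonempty) (c : ℝ) (R : Matrix ι ι ℂ) :
    ∃ W ∈ C, ∀ W' ∈ C, frobSq (c • W' - R) = frobSq (c • W - R) →
      c • W' - R = c • W - R := by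
  have hcont : Continuous fun W : Matrix ι ι ℂ => frobSq (c • W - R) := by
    unfold frobSq
    refine continuous_finsetSum _ fun x _ => continuous_finsetSum _ fun y _ => ?_
    refine (Continuous.norm ?_).pow 2
    exact ((continuous_id.const_smul c).sub continuous_const).matrix_elem x y
  obtain ⟨W, hW, hmin⟩ := hcomp.exists_isMinOn hne hcont.continuousOn
  refine ⟨W, hW, fun W' hW' heq => ?_⟩
  -- If two minimisers had different differences from `R`, the parallelogram law would make their
  -- midpoint strictly closer.
  have hmid := hmin (hconv hW' hW (by norm_num : (0 : ℝ) ≤ 1 / 2) (by norm_num) (by norm_num) :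
    (1 / 2 : ℝ) • W' + (1 / 2 : ℝ) • W ∈ C)
  have hD : c • ((1 / 2 : ℝ) • W' + (1 / 2 : ℝ) • W) - R =
      (1 / 2 : ℝ) • (c • W' - R) + (1 / 2 : ℝ) • (c • W - R) := by module
  have hpar := frobSq_parallelogram (c • W' - R) (c • W - R)
  simp only [Set.mem_ofPred_eq, hD] at hmid
  have := eq_zero_of_frobSq_le_zero (D := (c • W' - R) - (c • W - R)) (by linarith)
  exact sub_eq_zero.mp this

/-- The tensors invariant under all unitaries. -/
def invariantTensors (ι : Type*) [Fintype ι] [DecidableEq ι] :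
    Submodule ℂ (ι → ι → ι → ι → ℂ) where
  carrier := {T | ∀ U : Matrix ι ι ℂ, U * Uᴴ = 1 → IsInvariantTensor U T}
  zero_mem' U _ p r q s := by simp
  add_mem' {T T'} h h' U hU p r q s := by
    simp only [Pi.add_apply, smul_add, Finset.sum_add_distrib]
    rw [← h U hU, ← h' U hU]
  smul_mem' c T h U hU p r q s := by
    simp only [Pi.smul_apply]
    rw [h U hU p r q s]
    simp only [Finset.mul_sum, smul_eq_mul]
    refine Finset.sum_congr rfl fun _ _ => Finset.sum_congr rfl fun _ _ =>
      Finset.sum_congr rfl fun _ _ => Finset.sum_congr rfl fun _ _ => by ring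

/-- The operators invariant under all `U ⊗ V ⊗ conj U ⊗ conj V`. -/
theorem exists_eq_smul_pairTensor_of_invariant
    {D : Matrix ((a × b) × (a × b)) ((a × b) × (a × b)) ℂ}
    (h : ∀ (U : Matrix a a ℂ) (V : Matrix b b ℂ), U * Uᴴ = 1 → V * Vᴴ = 1 →
      pairTensor (conjDouble U) (conjDouble V) * D *
        (pairTensor (conjDouble U) (conjDouble V))ᴴ = D) :
    ∃ c₁ c₂ c₃ c₄ : ℂ, D = c₁ • pairTensor 1 1 + c₂ • pairTensor 1 (omega b) +
      c₃ • pairTensor (omega a) 1 + c₄ • pairTensor (omega a) (omega b) := by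
  -- Currying `D` as an A-tensor with values in B-tensors lets the one-group classification be
  -- applied twice; the submodule of invariant B-tensors keeps the coefficients of the first
  -- application invariant for the second.
  let T : a → a → a → a → (b → b → b → b → ℂ) := fun p₁ r₁ q₁ s₁ p₂ r₂ q₂ s₂ =>
    D ((p₁, p₂), (r₁, r₂)) ((q₁, q₂), (s₁, s₂))
  have hT : ∀ p r q s, T p r q s ∈ invariantTensors b := by
    intro p₁ r₁ q₁ s₁ V hV p₂ r₂ q₂ s₂
    have := congrFun (congrFun (h 1 V (by simp) hV) ((p₁, p₂), (r₁, r₂))) ((q₁, q₂), (s₁, s₂))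
    change D _ _ = _
    rw [← this]
    rw [conj_pairTensor_apply, conjDouble_one, Fintype.sum_eq_single (p₁, r₁)
      (fun u hu => by simp [one_apply_ne hu.symm]), Fintype.sum_prod_type]
    refine Finset.sum_congr rfl fun p' _ => Finset.sum_congr rfl fun r' _ => ?_
    rw [Fintype.sum_eq_single (q₁, s₁) (fun u hu => by simp [one_apply_ne hu.symm]),
      Fintype.sum_prod_type]
    refine Finset.sum_congr rfl fun q' _ => Finset.sum_congr rfl fun s' _ => ?_
    simp only [conjDouble_apply, one_apply_eq, star_mul', star_star, star_one, smul_eq_mul, T]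
    ring
  have hinv : ∀ U : Matrix a a ℂ, U * Uᴴ = 1 → IsInvariantTensor U T := by
    intro U hU p₁ r₁ q₁ s₁
    ext p₂ r₂ q₂ s₂
    have := congrFun (congrFun (h U 1 hU (by simp)) ((p₁, p₂), (r₁, r₂))) ((q₁, q₂), (s₁, s₂))
    change D _ _ = _
    rw [← this]
    simp only [Finset.sum_apply, Pi.smul_apply]
    rw [conj_pairTensor_apply, conjDouble_one, Fintype.sum_prod_type]
    refine Finset.sum_congr rfl fun p' _ => Finset.sum_congr rfl fun r' _ => ?_
    rw [Fintype.sum_eq_single (p₂, r₂) (fun u hu => by simp [one_apply_ne hu.symm]),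
      Fintype.sum_prod_type]
    refine Finset.sum_congr rfl fun q' _ => Finset.sum_congr rfl fun s' _ => ?_
    rw [Fintype.sum_eq_single (q₂, s₂) (fun u hu => by simp [one_apply_ne hu.symm])]
    simp only [conjDouble_apply, one_apply_eq, star_mul', star_star, star_one, smul_eq_mul, T]
    ring
  obtain ⟨α, hα, β, hβ, hTαβ⟩ := exists_eq_of_invariant _ hT hinv
  obtain ⟨c₁, -, c₂, -, hα'⟩ := exists_eq_of_invariant (⊤ : Submodule ℂ ℂ)
    (fun _ _ _ _ => trivial) hα
  obtain ⟨c₃, -, c₄, -, hβ'⟩ := exists_eq_of_invariant (⊤ : Submodule ℂ ℂ)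
    (fun _ _ _ _ => trivial) hβ
  refine ⟨c₁, c₂, c₃, c₄, ?_⟩
  ext ⟨⟨p₁, p₂⟩, ⟨r₁, r₂⟩⟩ ⟨⟨q₁, q₂⟩, ⟨s₁, s₂⟩⟩
  have h1 := congrFun (congrFun (congrFun (congrFun (hTαβ p₁ r₁ q₁ s₁) p₂) r₂) q₂) s₂
  change D _ _ = _ at h1
  rw [h1]
  have hi : ∀ (P : Prop) [Decidable P] (x : b → b → b → b → ℂ), (if P then x else 0) p₂ r₂ q₂ s₂ =
      if P then x p₂ r₂ q₂ s₂ else 0 := by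
    intro P _ x; split_ifs <;> rfl
  simp only [Pi.add_apply, hi, hα', hβ', Matrix.add_apply, Matrix.smul_apply, pairTensor_apply,
    omega, of_apply, one_apply, Prod.mk.injEq, smul_eq_mul]
  split_ifs <;> ring

end Twirl

/-! ### The target Choi operator as a mixture of coisometry states. -/

section Separable

variable {a b : Type*} [Fintype a] [DecidableEq a] [Fintype b] [DecidableEq b]

/-- `card (a × b)` times the Choi operator of `Φ[-1/d_b, -1/d_b, 1]`. -/
noncomputable def isotropicChoi (a b : Type*) [Fintype a] [DecidableEq a] [Fintype b]
    [DecidableEq b] : Matrix ((a × b) × (a × b)) ((a × b) × (a × b)) ℂ :=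
  pairTensor 1 1 - (1 / (Fintype.card b : ℂ)) • pairTensor 1 (omega b) -
    (1 / (Fintype.card b : ℂ)) • pairTensor (omega a) 1 + pairTensor (omega a) (omega b)

theorem conj_isotropicChoi {U : Matrix a a ℂ} {V : Matrix b b ℂ} (hU : U * Uᴴ = 1)
    (hV : V * Vᴴ = 1) :
    pairTensor (conjDouble U) (conjDouble V) * isotropicChoi a b *
      (pairTensor (conjDouble U) (conjDouble V))ᴴ = isotropicChoi a b := by
  simp only [isotropicChoi, mul_sub, mul_add, sub_mul, add_mul, mul_smul_comm, smul_mul_assoc,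
    pairTensor_conj, conjDouble_conj_omega hU, conjDouble_conj_omega hV, mul_one,
    conjDouble_mul_conjTranspose hU, conjDouble_mul_conjTranspose hV]

theorem sum_sum_mul_omega (n : Type*) [Fintype n] [DecidableEq n] (f : n × n → n × n → ℂ) :
    ∑ w, ∑ w', f w w' * omega n w' w = ∑ j, ∑ k, f (j, j) (k, k) := by
  simp only [omega, of_apply, Fintype.sum_prod_type, mul_ite, mul_one, mul_zero, ite_and,
    Finset.sum_ite_eq, Finset.mem_univ, if_true]
  refine Finset.sum_congr rfl fun i _ => ?_
  rw [Finset.sum_comm]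
  refine Finset.sum_congr rfl fun j _ => ?_
  simp

theorem sum_sum_mul_one (n : Type*) [Fintype n] [DecidableEq n] (f : n → n → ℂ) :
    ∑ w, ∑ w', f w w' * (1 : Matrix n n ℂ) w' w = ∑ w, f w w := by
  simp [one_apply]

variable (M : Matrix a b ℂ)

omit [DecidableEq a] [DecidableEq b] in
theorem trace_vecMulVec_conjSquare_mul_pairTensor (X : Matrix (a × a) (a × a) ℂ)
    (Y : Matrix (b × b) (b × b) ℂ) :
    (vecMulVec (conjSquare fun p : a × b => M p.1 p.2)
      (star (conjSquare fun p : a × b => M p.1 p.2)) * pairTensor X Y).trace =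
    ∑ u, ∑ u', (∑ w, ∑ w', M u.1 w.1 * star (M u.2 w.2) * (star (M u'.1 w'.1) * M u'.2 w'.2) *
      Y w' w) * X u' u := by
  simp only [Matrix.trace, diag_apply, Matrix.mul_apply, vecMulVec_apply, Pi.star_apply]
  rw [sum_prod_prod_comm]
  refine Finset.sum_congr rfl fun u _ => ?_
  simp only [Finset.sum_mul]
  refine Eq.trans (Finset.sum_congr rfl fun w _ => ?_) Finset.sum_comm
  rw [sum_prod_prod_comm]
  refine Finset.sum_congr rfl fun u' _ => Finset.sum_congr rfl fun w' _ => ?_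
  simp only [conjSquare, pairTensor_apply, star_mul', star_star]
  ring

variable {M}

omit [DecidableEq b] in
theorem sum_mul_star_eq_card (hM : M * Mᴴ = 1) :
    ∑ i, ∑ j, M i j * star (M i j) = Fintype.card a := by
  have := congrArg Matrix.trace hM
  rw [Matrix.trace_one] at this
  rw [← this]
  simp [Matrix.trace, Matrix.mul_apply]

/-- The overlap is ‖φ‖⁴ = (Tr MMᴴ)². This and the next three overlaps depend on M only through MMᴴ =
1, so they are constant on the whole convex hull. -/
theorem trace_mul_one_one (hM : M * Mᴴ = 1) :
    (vecMulVec (conjSquare fun p : a × b => M p.1 p.2)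
      (star (conjSquare fun p : a × b => M p.1 p.2)) * pairTensor 1 1).trace =
    (Fintype.card a : ℂ) ^ 2 := by
  rw [trace_vecMulVec_conjSquare_mul_pairTensor, sum_sum_mul_one]
  simp only [sum_sum_mul_one]
  rw [sq, ← sum_mul_star_eq_card hM, Finset.sum_mul_sum, Fintype.sum_prod_type]
  refine Finset.sum_congr rfl fun i _ => Finset.sum_congr rfl fun j _ => ?_
  rw [Finset.sum_mul_sum, Fintype.sum_prod_type]
  refine Finset.sum_congr rfl fun k _ => Finset.sum_congr rfl fun l _ => ?_
  ring

/-- Contracting the B indices gives Tr((MMᴴ)²). -/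
theorem trace_mul_one_omega (hM : M * Mᴴ = 1) :
    (vecMulVec (conjSquare fun p : a × b => M p.1 p.2)
      (star (conjSquare fun p : a × b => M p.1 p.2)) * pairTensor 1 (omega b)).trace =
    (Fintype.card a : ℂ) := by
  rw [trace_vecMulVec_conjSquare_mul_pairTensor, sum_sum_mul_one]
  simp only [sum_sum_mul_omega]
  have h : ∀ u : a × a, ∑ j, ∑ k, M u.1 j * star (M u.2 j) * (star (M u.1 k) * M u.2 k) =
      (M * Mᴴ) u.1 u.2 * (M * Mᴴ) u.2 u.1 := by
    intro u
    rw [Matrix.mul_apply, Matrix.mul_apply, Finset.sum_mul_sum]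
    refine Finset.sum_congr rfl fun j _ => Finset.sum_congr rfl fun k _ => ?_
    simp only [conjTranspose_apply]
    ring
  simp only [h, hM, Fintype.sum_prod_type, one_apply]
  simp

/-- Contracting the A indices gives Tr((MᴴM)²), which cyclicity reduces to Tr(MMᴴ). -/
theorem trace_mul_omega_one (hM : M * Mᴴ = 1) :
    (vecMulVec (conjSquare fun p : a × b => M p.1 p.2)
      (star (conjSquare fun p : a × b => M p.1 p.2)) * pairTensor (omega a) 1).trace =
    (Fintype.card a : ℂ) := by
  rw [trace_vecMulVec_conjSquare_mul_pairTensor, sum_sum_mul_omega]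
  simp only [sum_sum_mul_one]
  have h : (Mᴴ * M * (Mᴴ * M)).trace = (Fintype.card a : ℂ) := by
    calc (Mᴴ * M * (Mᴴ * M)).trace = (Mᴴ * (M * Mᴴ) * M).trace := by
          simp only [Matrix.mul_assoc]
      _ = (Fintype.card a : ℂ) := by
          rw [hM, Matrix.mul_one, Matrix.trace_mul_comm, hM, Matrix.trace_one]
  have h' : ∀ w : b × b, ∑ i, ∑ k, M i w.1 * star (M i w.2) * (star (M k w.1) * M k w.2) =
      (Mᴴ * M) w.2 w.1 * (Mᴴ * M) w.1 w.2 := by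
    intro w
    rw [Matrix.mul_apply, Matrix.mul_apply, Finset.sum_mul_sum]
    refine Finset.sum_congr rfl fun i _ => Finset.sum_congr rfl fun k _ => ?_
    simp only [conjTranspose_apply]
    ring
  calc _ = ∑ i, ∑ w : b × b, ∑ k, M i w.1 * star (M i w.2) * (star (M k w.1) * M k w.2) :=
        Finset.sum_congr rfl fun i _ => Finset.sum_comm
    _ = ∑ w : b × b, (Mᴴ * M) w.2 w.1 * (Mᴴ * M) w.1 w.2 := by
        rw [Finset.sum_comm]
        exact Finset.sum_congr rfl fun w _ => h' w
    _ = (Mᴴ * M * (Mᴴ * M)).trace := by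
        rw [Fintype.sum_prod_type, Finset.sum_comm]
        simp only [Matrix.trace, diag_apply, Matrix.mul_apply (M := Mᴴ * M)]
    _ = (Fintype.card a : ℂ) := h

theorem trace_mul_omega_omega (hM : M * Mᴴ = 1) :
    (vecMulVec (conjSquare fun p : a × b => M p.1 p.2)
      (star (conjSquare fun p : a × b => M p.1 p.2)) * pairTensor (omega a) (omega b)).trace =
    (Fintype.card a : ℂ) ^ 2 := by
  rw [trace_vecMulVec_conjSquare_mul_pairTensor, sum_sum_mul_omega]
  simp only [sum_sum_mul_omega]
  rw [sq, ← sum_mul_star_eq_card hM, Finset.sum_mul_sum]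
  refine Finset.sum_congr rfl fun i _ => Finset.sum_congr rfl fun j _ => ?_
  rw [Finset.sum_mul_sum]
  refine Finset.sum_congr rfl fun k _ => Finset.sum_congr rfl fun l _ => ?_
  ring

theorem trace_mul_eq_of_mem_convexHull {ι : Type*} [Fintype ι] {K : Set (Matrix ι ι ℂ)}
    {B : Matrix ι ι ℂ} {t : ℂ} (h : ∀ W ∈ K, (W * B).trace = t) {W : Matrix ι ι ℂ}
    (hW : W ∈ convexHull ℝ K) : (W * B).trace = t := by
  have hconv : Convex ℝ {W : Matrix ι ι ℂ | (W * B).trace = t} := by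
    intro x hx y hy u v _ _ huv
    change ((u • x + v • y) * B).trace = t
    rw [add_mul, smul_mul_assoc, smul_mul_assoc, Matrix.trace_add, Matrix.trace_smul,
      Matrix.trace_smul, show (x * B).trace = t from hx, show (y * B).trace = t from hy,
      ← add_smul, huv, one_smul]
  exact convexHull_min h hconv hW

theorem coisometryStates_nonempty (hab : Fintype.card a ≤ Fintype.card b) :
    (coisometryStates a b).Nonempty := by
  obtain ⟨e⟩ := Function.Embedding.nonempty_of_card_le hab
  refine Set.Nonempty.image _ ⟨Matrix.of fun i j => if e i = j then 1 else 0, ?_⟩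
  ext i j
  simp [Matrix.mul_apply, one_apply, eq_comm]

theorem exists_smul_eq_isotropicChoi [Nonempty b] (hab : Fintype.card a ≤ Fintype.card b) :
    ∃ W ∈ convexHull ℝ (coisometryStates a b),
      ((Fintype.card b : ℝ) ^ 2 - 1) • W = isotropicChoi a b := by
  have hb : (Fintype.card b : ℂ) ≠ 0 := by exact_mod_cast Fintype.card_ne_zero
  obtain ⟨W, hW, huniq⟩ := exists_forall_frobSq_eq
    (isCompact_convexHull_of_finiteDimensional (isCompact_coisometryStates (a := a) (b := b)))
    (convex_convexHull ℝ _) (coisometryStates_nonempty hab).convexHull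
    ((Fintype.card b : ℝ) ^ 2 - 1) (isotropicChoi a b)
  refine ⟨W, hW, ?_⟩
  -- The factor is forced by the trace: the target has trace dA²(dB²-1) and each coisometry state
  -- dA². It vanishes for dB = 1, hence the distance is measured after scaling by `c` instead of
  -- dividing the target.
  set c : ℝ := (Fintype.card b : ℝ) ^ 2 - 1 with hc
  set D := c • W - isotropicChoi a b with hD
  have hinv : ∀ (U : Matrix a a ℂ) (V : Matrix b b ℂ), U * Uᴴ = 1 → V * Vᴴ = 1 →
      pairTensor (conjDouble U) (conjDouble V) * D *
        (pairTensor (conjDouble U) (conjDouble V))ᴴ = D := by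
    intro U V hU hV
    set G := pairTensor (conjDouble U) (conjDouble V) with hG
    have hGG : G * Gᴴ = 1 := by
      rw [hG, conjTranspose_pairTensor, pairTensor_mul, conjDouble_mul_conjTranspose hU,
        conjDouble_mul_conjTranspose hV, pairTensor_one_one]
    have hGD : c • (G * W * Gᴴ) - isotropicChoi a b = G * D * Gᴴ := by
      rw [hD, mul_sub, sub_mul, conj_isotropicChoi hU hV, mul_smul_comm, smul_mul_assoc]
    rw [← hGD]
    -- The conjugated point lies in the hull at the same distance from the invariant target, so
    -- uniqueness makes `D` invariant.
    refine huniq _ (conj_mem_convexHull (fun W hW => conj_mem_coisometryStates hU hV hW) hW) ?_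
    rw [hGD, frobSq_conj hGG]
  obtain ⟨c₁, c₂, c₃, c₄, hDc⟩ := exists_eq_smul_pairTensor_of_invariant hinv
  have htr : ∀ (B : Matrix ((a × b) × (a × b)) ((a × b) × (a × b)) ℂ) (t : ℂ),
      (∀ W ∈ coisometryStates a b, (W * B).trace = t) →
      (c : ℂ) * t = (isotropicChoi a b * B).trace → (D * B).trace = 0 := by
    intro B t h h'
    rw [hD, sub_mul, smul_mul_assoc, Matrix.trace_sub, Matrix.trace_smul,
      trace_mul_eq_of_mem_convexHull h hW, ← h', Complex.real_smul, sub_self]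
  have h₁ : (D * pairTensor 1 1).trace = 0 := by
    refine htr _ _ (by rintro _ ⟨M, hM, rfl⟩; exact trace_mul_one_one hM) ?_
    simp only [isotropicChoi, sub_mul, add_mul, smul_mul_assoc, pairTensor_mul, mul_one,
      Matrix.trace_add, Matrix.trace_sub, Matrix.trace_smul, trace_pairTensor, trace_omega,
      Matrix.trace_one, Fintype.card_prod, hc, smul_eq_mul]
    push_cast
    field_simp
    ring
  have h₂ : (D * pairTensor 1 (omega b)).trace = 0 := by
    refine htr _ _ (by rintro _ ⟨M, hM, rfl⟩; exact trace_mul_one_omega hM) ?_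
    simp only [isotropicChoi, sub_mul, add_mul, smul_mul_assoc, pairTensor_mul, one_mul, mul_one,
      omega_mul_self, Matrix.trace_add, Matrix.trace_sub, Matrix.trace_smul, trace_pairTensor,
      trace_omega, Matrix.trace_one, Fintype.card_prod, hc, smul_eq_mul]
    push_cast
    field_simp
    ring
  have h₃ : (D * pairTensor (omega a) 1).trace = 0 := by
    refine htr _ _ (by rintro _ ⟨M, hM, rfl⟩; exact trace_mul_omega_one hM) ?_
    simp only [isotropicChoi, sub_mul, add_mul, smul_mul_assoc, pairTensor_mul, one_mul, mul_one,
      omega_mul_self, Matrix.trace_add, Matrix.trace_sub, Matrix.trace_smul, trace_pairTensor,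
      trace_omega, Matrix.trace_one, Fintype.card_prod, hc, smul_eq_mul]
    push_cast
    field_simp
    ring
  have h₄ : (D * pairTensor (omega a) (omega b)).trace = 0 := by
    refine htr _ _ (by rintro _ ⟨M, hM, rfl⟩; exact trace_mul_omega_omega hM) ?_
    simp only [isotropicChoi, sub_mul, add_mul, smul_mul_assoc, pairTensor_mul, one_mul,
      omega_mul_self, Matrix.trace_add, Matrix.trace_sub, Matrix.trace_smul, trace_pairTensor,
      trace_omega, hc, smul_eq_mul]
    push_cast
    field_simp
    ring
  -- Dᴴ lies in the span of the same four Hermitian operators, to each of which `D` is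
  -- trace-orthogonal.
  have hD0 : (D * Dᴴ).trace = 0 := by
    have hDH : Dᴴ = star c₁ • pairTensor 1 1 + star c₂ • pairTensor 1 (omega b) +
        star c₃ • pairTensor (omega a) 1 + star c₄ • pairTensor (omega a) (omega b) := by
      rw [hDc]
      simp only [conjTranspose_add, conjTranspose_smul, conjTranspose_pairTensor,
        conjTranspose_one, (omega_isHermitian _).eq]
    rw [hDH]
    simp only [mul_add, mul_smul_comm, Matrix.trace_add, Matrix.trace_smul, h₁, h₂, h₃, h₄,
      smul_zero, add_zero]
  exact sub_eq_zero.mp (trace_mul_conjTranspose_self_eq_zero_iff.mp hD0)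

end Separable

theorem Phi_isEntanglementBreaking {dA dB : ℕ} (hA : 1 ≤ dA) (hAB : dA ≤ dB) :
    IsEntanglementBreaking (Phi dA dB (-1 / dB) (-1 / dB) 1) := by
  have hB : 1 ≤ dB := hA.trans hAB
  have hne : Nonempty (Fin dB) := ⟨⟨0, hB⟩⟩
  have hA' : (dA : ℂ) ≠ 0 := by exact_mod_cast (by omega : dA ≠ 0)
  have hB' : (dB : ℂ) ≠ 0 := by exact_mod_cast (by omega : dB ≠ 0)
  obtain ⟨W, hW, hWR⟩ := exists_smul_eq_isotropicChoi (a := Fin dA) (b := Fin dB) (by simpa)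
  -- Membership in the hull already supplies a finite decomposition, as the definition of
  -- separability requires.
  obtain ⟨κ, _, w, z, hw, -, hz, rfl⟩ := mem_convexHull_iff_exists_fintype.mp hW
  choose M _ hM using hz
  refine isEntanglementBreaking_of_choi_eq_sum (κ := κ) (fun k => ((dB : ℝ) ^ 2 - 1) * w k)
    (fun k => mul_nonneg ?_ (hw k)) (fun k p => M k p.1 p.2) ?_
  · have : (1 : ℝ) ≤ dB := by exact_mod_cast hB
    nlinarith
  · have hchoi := smul_choi_Phi hA hB (-1 / dB) (-1 / dB) 1
    simp only [Fintype.card_prod, Fintype.card_fin, Nat.cast_mul]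
    rw [hchoi]
    have hR : (1 + (((-1 / dB : ℝ) : ℂ) * dB) • pairTensor 1 (maxEnt (Fin dB)) +
        (((-1 / dB : ℝ) : ℂ) * dA) • pairTensor (maxEnt (Fin dA)) 1 +
        (((1 : ℝ) : ℂ) * (dA * dB)) • pairTensor (maxEnt (Fin dA)) (maxEnt (Fin dB))) =
        isotropicChoi (Fin dA) (Fin dB) := by
      simp only [isotropicChoi, maxEnt_eq_smul_omega, pairTensor_smul_left, pairTensor_smul_right,
        Fintype.card_fin, pairTensor_one_one]
      push_cast
      match_scalars <;> field_simp
    rw [hR, ← hWR, Finset.smul_sum]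
    refine Finset.sum_congr rfl fun k _ => ?_
    rw [smul_smul, Fintype.card_fin, ← hM k]

end QMaps

theorem mainTheorem9 (dA dB : ℕ) (hA : 1 ≤ dA) :
    (2 ≤ dA → dA < dB →
      opR dA dB = ((dA : ℂ) * dB) •
        choi (Phi dA dB (-1 / dB) (-1 / dA) (1 - ((dB : ℝ) - dA) / (dA * dB))) ∧
      IsPPTEntangledState ((opR dA dB).trace⁻¹ • opR dA dB)) ∧
    (dA < dB →
      IsPositiveMap (redMap dA dB) ∧
      (2 ≤ dA → ¬ IsDecomposable (redMap dA dB) ∧ Detects (redMap dA dB) (opR dA dB))) ∧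
    (dA ≤ dB → IsEntanglementBreaking (Phi dA dB (-1 / dB) (-1 / dB) 1)) := by
  refine ⟨fun h2 hAB => ⟨opR_eq_choi hA (by omega), opR_isPPTEntangledState h2 hAB⟩,
    fun hAB => ⟨redMap_isPositiveMap dA dB hA, fun h2 => ⟨fun hdec => ?_,
      redMap_detects_opR h2 hAB⟩⟩, Phi_isEntanglementBreaking hA⟩
  exact redMap_detects_opR h2 hAB
    (hdec.leftAmp_posSemidef (opR_posSemidef hA (by omega)) (opR_ppt hA hAB))
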